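/- For integers $a,b$ and $n\ge 1$ let $$S(a,b;n)=\sum_{\substack{x \bmod n\\ x\overline{x}\equiv 1 \bmod n}} e^{2\pi i (ax+b\overline{x})/n}$$ be the Kloosterman sum, let $\omega(n)$ be the number of distinct prime factors of $n$, let $\pi(X)$ be the number of primes $p\le X$, and let $\zeta(2)=\sum_{m\ge1}m^{-2}$. There is an absolute constant $\beta$ such that the following holds for all integers $a\ne0$ and $b\ne0$. Let $(\eta_i)_{i\ge0}$ be any sequence of complex numbers with $\eta_i\neq0$ for all $i\ge1$ (for instance a constant sequence $\eta_i=\eta\ne0$; the value $\eta_0$ only concerns $n=1$ and is arbitrary), and let $f$ be any complex-valued multiplicative function. For real $X\ge1$ put $$E(X)=\#\{n\le X: n \text{ square-free},\ S(a,b;n)=\eta_{\omega(n)}f(n)\},\qquad N(X)=\#\{n\le X: n \text{ square-free},\ S(a,b;n)\ne\eta_{\omega(n)}f(n)\}.$$ Then for all $X\ge1$ $$E(X)\le \pi(X)+(10|a|+10|b|+\beta)\,Xe^{-\sqrt{\log X}},$$ $$\frac{X}{\zeta(2)}-\pi(X)-(10|a|+10|b|+\beta+6)\,Xe^{-\sqrt{\log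 X}}\le N(X)\le \frac{X}{\zeta(2)}+3\sqrt X .$$ In particular $S(a,b;n)\ne\eta_{\omega(n)}f(n)$ holds for $100\%$ of the square-free $n$, that is, $N(X)/\#\{n\le X: n\text{ square-free}\}\to1$ as $X\to\infty$, and $$N(X)=\frac{X}{\zeta(2)}+O(\pi(X))\qquad (X\to\infty),$$ where the implied constant and the threshold for $X$ depend only on $a$ and $b$ (not on $(\eta_i)$ or $f$). -/

import Mathlib

open Filter Topology

noncomputable section

/-- The Kloosterman sum `S(a,b;c) = ∑ e((a x + b x̄)/c)`, where `e(t) = exp(2πit)`, the sum runs over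
the residues `x` modulo `c` that are invertible modulo `c`, and `x̄` is the inverse of `x` modulo `c`
(represented in `[0, c)`). It is used for `c ≥ 1`. -/
def kloostermanSum (a b : ℤ) (c : ℕ) : ℂ :=
  ∑ x ∈ (Finset.range c).filter (fun x : ℕ => Nat.Coprime x c),
    Complex.exp (2 * (Real.pi : ℂ) * Complex.I *
      (((a : ℂ) * (x : ℂ) + (b : ℂ) * ((((x : ZMod c)⁻¹).val : ℕ) : ℂ)) / (c : ℂ)))

/-- `π(X)`: the number of primes `p ≤ X`. -/
def primePi (X : ℝ) : ℝ := (Nat.primeCounting ⌊X⌋₊ : ℝ)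

/-- The number of square-free positive integers `n ≤ X`. -/
def squarefreeCount (X : ℝ) : ℝ :=
  (Set.ncard {n : ℕ | 1 ≤ n ∧ (n : ℝ) ≤ X ∧ Squarefree n} : ℝ)

/-- The number of square-free positive integers `n ≤ X` with `S(a,b;n) = η_{ω(n)} f(n)`. -/
def kloostermanEqCount (a b : ℤ) (η : ℕ → ℂ) (f : ArithmeticFunction ℂ) (X : ℝ) : ℝ :=
  (Set.ncard {n : ℕ | 1 ≤ n ∧ (n : ℝ) ≤ X ∧ Squarefree n ∧
    kloostermanSum a b n = η (ArithmeticFunction.cardDistinctFactors n) * f n} : ℝ)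

/-- The number of square-free positive integers `n ≤ X` with `S(a,b;n) ≠ η_{ω(n)} f(n)`. -/
def kloostermanNeCount (a b : ℤ) (η : ℕ → ℂ) (f : ArithmeticFunction ℂ) (X : ℝ) : ℝ :=
  (Set.ncard {n : ℕ | 1 ≤ n ∧ (n : ℝ) ≤ X ∧ Squarefree n ∧
    kloostermanSum a b n ≠ η (ArithmeticFunction.cardDistinctFactors n) * f n} : ℝ)

/-- `ζ(2) = ∑_{m ≥ 1} 1/m²`. -/
def zetaTwo : ℝ := ∑' m : ℕ, 1 / ((m : ℝ) + 1) ^ 2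

end

/-! Suppose the relation `S(a,b;n) = η_{ω(n)} f(n)` holds at the four square-free numbers `pm, pm',
qm, qm'`, with `p ≠ q` primes. The values of `f` and of `η` cancel, leaving `S(pm) S(qm') = S(pm')
S(qm)`. Apply the Galois automorphism `ζ ↦ ζ^t` with `t ≡ 2 mod p` and `t ≡ 1` modulo the rest of
the level. By twisted multiplicativity only the factors of modulus `p` change. All Kloosterman sums
of square-free modulus are nonzero, so dividing the two relations leaves an identity between four
sums modulo `p`. With `λ = ζ_p - 1`, a sum with arguments `α, β` is `-1 - αβ λ²` modulo `λ³` when `p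
≥ 5`, and comparing `λ²` terms gives `m² ≡ m'² mod p` if `p ∤ ab`
(`natCast_sq_eq_of_kloostermanSum_rectangle`).

Join `p` to `m` when `pm` is a solution. Put `L = √(log X)` and keep only primes `p > exp(4L)`. For
`m ≠ m'` the common neighbours, if there are at least two, all divide the nonzero number `m² - m'²`
of size at most `X²`, so there are at most `L/2` of them. A weighted Kővári–Sós–Turán argument
(`sum_card_le_of_card_common_le`) then bounds the number of edges by `π(X)` plus a small error; the
coefficient 1 of `π(X)` comes from allowing each prime one free edge. The solutions that give no
edge either have no prime factor above `exp(4L)`, and are rare by Rankin's trick, or have such a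
factor dividing `ab`. Finally, `N(X)` is the square-free count minus `E(X)`. -/

noncomputable section
open Polynomial

/-! ### Kloosterman sums as values of integer polynomials at roots of unity -/

/-- The Kloosterman sum with arguments in `ZMod c`, as a sum over the units of `ZMod c`. -/
def unitKloosterman (c : ℕ) [NeZero c] (α β : ZMod c) : ℂ :=
  ∑ u : (ZMod c)ˣ, ZMod.stdAddChar (α * (u : ZMod c) + β * ((u⁻¹ : (ZMod c)ˣ) : ZMod c))

/-- The Kloosterman sum as a polynomial in the root of unity. -/
def kloostermanPoly (c : ℕ) [NeZero c] (α β : ZMod c) : ℤ[X] :=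
  ∑ u : (ZMod c)ˣ, X ^ (α * (u : ZMod c) + β * ((u⁻¹ : (ZMod c)ˣ) : ZMod c)).val

theorem kloostermanSum_eq_unitKloosterman (a b : ℤ) (c : ℕ) [NeZero c] :
    kloostermanSum a b c = unitKloosterman c a b := by
  unfold kloostermanSum unitKloosterman
  refine Finset.sum_bij' (fun x hx => ZMod.unitOfCoprime x (Finset.mem_filter.1 hx).2)
    (fun u _ => (u : ZMod c).val) ?_ ?_ ?_ ?_ ?_
  · intros; simp
  · intro u _
    simp only [Finset.mem_filter, Finset.mem_range]
    exact ⟨ZMod.val_lt _, ZMod.val_coe_unit_coprime u⟩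
  · intro x hx
    simp only [Finset.mem_filter, Finset.mem_range] at hx
    simp [ZMod.val_natCast, Nat.mod_eq_of_lt hx.1]
  · intro u _
    ext
    simp
  · intro x hx
    have h1 : ((ZMod.unitOfCoprime x (Finset.mem_filter.1 hx).2)⁻¹ : (ZMod c)ˣ) =
        ((x : ZMod c)⁻¹) := by
      rw [← ZMod.inv_coe_unit, ZMod.coe_unitOfCoprime]
    rw [h1, ZMod.coe_unitOfCoprime]
    have := ZMod.stdAddChar_coe (N := c) (a * x + b * (((x : ZMod c)⁻¹).val : ℤ))
    push_cast at this
    rw [ZMod.natCast_zmod_val] at this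
    rw [this]
    congr 1
    ring

/-- Expanding by `k = n / c` turns `ζ_n` into `ζ_c`, so sums of different moduli become polynomials
in a single root of unity. Replacing `ζ` by `ζ^t` multiplies both arguments by `t`. -/
theorem aeval_kloostermanPoly {n c k : ℕ} [NeZero n] [NeZero c] (hn : n = c * k) (t : ℕ)
    (α β : ZMod c) :
    aeval (Complex.exp (2 * Real.pi * Complex.I / n) ^ t) (expand ℤ k (kloostermanPoly c α β)) =
      unitKloosterman c (t * α) (t * β) := by
  rw [expand_aeval, kloostermanPoly, unitKloosterman, map_sum]
  refine Finset.sum_congr rfl fun u _ => ?_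
  have h : ((t : ZMod c) * α * u + t * β * (u⁻¹ : (ZMod c)ˣ)) =
      (((t * (α * u + β * ((u⁻¹ : (ZMod c)ˣ) : ZMod c)).val : ℕ) : ℤ) : ZMod c) := by
    push_cast
    rw [ZMod.natCast_zmod_val]
    ring
  rw [h, ZMod.stdAddChar_coe, map_pow, aeval_X, ← Complex.exp_nat_mul, ← Complex.exp_nat_mul,
    ← Complex.exp_nat_mul]
  congr 1
  have hc : (c : ℂ) ≠ 0 := by exact_mod_cast NeZero.ne c
  have hk : (k : ℂ) ≠ 0 := by
    rintro hk
    have : k = 0 := by exact_mod_cast hk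
    exact NeZero.ne n (by simp [hn, this])
  rw [hn]
  push_cast
  field_simp

/-- Galois conjugation: `ζ` and `ζ^t` share their minimal polynomial over `ℤ`, which divides `G`. -/
theorem aeval_pow_eq_zero_of_coprime {n t : ℕ} [NeZero n] (ht : t.Coprime n) {G : ℤ[X]}
    (hG : aeval (Complex.exp (2 * Real.pi * Complex.I / n)) G = 0) :
    aeval (Complex.exp (2 * Real.pi * Complex.I / n) ^ t) G = 0 := by
  have hζ := Complex.isPrimitiveRoot_exp n (NeZero.ne n)
  have h1 := minpoly.isIntegrallyClosed_dvd (hζ.isIntegral (NeZero.pos n)) hG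
  rw [hζ.minpoly_eq_pow_coprime ht] at h1
  obtain ⟨H, rfl⟩ := h1
  simp [minpoly.aeval]

/-! ### Expansion at `X = 1` modulo `p` for prime modulus -/

/-- Total ramification of `p` in `ℤ[ζ_p]`, in polynomial form: `Φ_p` divides `G`, and `Φ_p = (X -
1)^(p-1)` modulo `p`. A relation at `ζ_p` thus forces the first `p - 1` Taylor coefficients at 1 to
vanish modulo `p`. -/
theorem X_sub_one_pow_dvd_map {p : ℕ} [hp : Fact p.Prime] {G : ℤ[X]}
    (hG : aeval (Complex.exp (2 * Real.pi * Complex.I / p)) G = 0) :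
    (X - 1) ^ (p - 1) ∣ G.map (Int.castRingHom (ZMod p)) := by
  have hζ := Complex.isPrimitiveRoot_exp p hp.out.ne_zero
  have h1 := minpoly.isIntegrallyClosed_dvd (hζ.isIntegral hp.out.pos) hG
  rw [← cyclotomic_eq_minpoly hζ hp.out.pos] at h1
  have h2 := Polynomial.map_dvd (Int.castRingHom (ZMod p)) h1
  rw [map_cyclotomic] at h2
  have h3 := cyclotomic_mul_prime_pow_eq (ZMod p) (p := p) (m := 1) (k := 1)
    (by simpa using hp.out.one_lt.ne') one_pos
  simp only [pow_one, mul_one, Nat.sub_self, pow_zero, cyclotomic_one] at h3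
  rwa [h3] at h2

theorem eval_one_map_kloostermanPoly {p : ℕ} [hp : Fact p.Prime] (α β : ZMod p) :
    ((kloostermanPoly p α β).map (Int.castRingHom (ZMod p))).eval 1 = -1 := by
  simp only [kloostermanPoly, Polynomial.map_sum, Polynomial.map_pow, map_X, eval_finsetSum,
    eval_pow, eval_X, one_pow, Finset.sum_const, Finset.card_univ, ZMod.card_units,
    nsmul_eq_mul, mul_one]
  rw [Nat.cast_sub hp.out.one_le]
  simp

theorem sum_units_pow_eq_zero {p : ℕ} [hp : Fact p.Prime] (i : ℕ) (hi : ¬ (p - 1) ∣ i) :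
    ∑ u : (ZMod p)ˣ, (u : ZMod p) ^ i = 0 := by
  have := FiniteField.sum_pow_units (ZMod p) i
  rw [ZMod.card, if_neg hi] at this
  simpa using this

theorem sum_units_inv_pow_eq_zero {p : ℕ} [hp : Fact p.Prime] (i : ℕ) (hi : ¬ (p - 1) ∣ i) :
    ∑ u : (ZMod p)ˣ, ((u⁻¹ : (ZMod p)ˣ) : ZMod p) ^ i = 0 := by
  rw [← sum_units_pow_eq_zero i hi]
  exact Equiv.sum_comp (Equiv.inv (ZMod p)ˣ) fun u => (u : ZMod p) ^ i

theorem sum_units_linear {p : ℕ} [hp : Fact p.Prime] (h5 : 5 ≤ p) (α β : ZMod p) :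
    ∑ u : (ZMod p)ˣ, (α * u + β * (u⁻¹ : (ZMod p)ˣ)) = 0 := by
  have hi : ¬ (p - 1) ∣ 1 := fun h => by have := Nat.le_of_dvd one_pos h; omega
  have h1 := sum_units_pow_eq_zero 1 hi
  have h2 := sum_units_inv_pow_eq_zero 1 hi
  simp only [pow_one] at h1 h2
  rw [Finset.sum_add_distrib, ← Finset.mul_sum, ← Finset.mul_sum, h1, h2]
  simp

/-- Since `p - 1 ∤ 2`, the two pure squares sum to zero; only the cross term `2αβ` survives, taken
`p - 1 ≡ -1` times. -/
theorem sum_units_square {p : ℕ} [hp : Fact p.Prime] (h5 : 5 ≤ p) (α β : ZMod p) :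
    ∑ u : (ZMod p)ˣ, (α * u + β * (u⁻¹ : (ZMod p)ˣ)) ^ 2 = -(2 * α * β) := by
  have hi : ¬ (p - 1) ∣ 2 := fun h => by have := Nat.le_of_dvd two_pos h; omega
  have h1 := sum_units_pow_eq_zero 2 hi
  have h2 := sum_units_inv_pow_eq_zero 2 hi
  have h3 : ∀ u : (ZMod p)ˣ, (α * u + β * (u⁻¹ : (ZMod p)ˣ)) ^ 2 =
      α ^ 2 * (u : ZMod p) ^ 2 + β ^ 2 * ((u⁻¹ : (ZMod p)ˣ) : ZMod p) ^ 2 + 2 * α * β := by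
    intro u
    have : (u : ZMod p) * ((u⁻¹ : (ZMod p)ˣ) : ZMod p) = 1 := Units.mul_inv u
    linear_combination (2 * α * β) * this
  simp only [h3, Finset.sum_add_distrib, ← Finset.mul_sum, h1, h2, Finset.sum_const,
    Finset.card_univ, ZMod.card_units, nsmul_eq_mul]
  rw [Nat.cast_sub hp.out.one_le]
  simp

theorem eval_one_derivative_map_kloostermanPoly {p : ℕ} [hp : Fact p.Prime] (h5 : 5 ≤ p)
    (α β : ZMod p) :
    (derivative ((kloostermanPoly p α β).map (Int.castRingHom (ZMod p)))).eval 1 = 0 := by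
  simp only [kloostermanPoly, Polynomial.map_sum, Polynomial.map_pow, map_X, derivative_sum,
    derivative_X_pow, eval_finsetSum, eval_mul, eval_C, eval_pow, eval_X, one_pow, mul_one,
    ZMod.natCast_zmod_val]
  exact sum_units_linear h5 α β

/-- The truncated subtraction in the exponent of a second derivative is harmless: at `val = 0` the
factor `x` vanishes. -/
theorem ZMod.mul_natCast_val_sub_one {n : ℕ} [NeZero n] (x : ZMod n) :
    x * ((x.val - 1 : ℕ) : ZMod n) = x ^ 2 - x := by
  have h : ∀ k : ℕ, (k : ZMod n) * ((k - 1 : ℕ) : ZMod n) = (k : ZMod n) ^ 2 - k := by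
    rintro (_ | k)
    · simp
    · push_cast [Nat.add_sub_cancel]; ring
  simpa using h x.val

theorem eval_one_derivative_derivative_map_kloostermanPoly {p : ℕ} [hp : Fact p.Prime]
    (h5 : 5 ≤ p) (α β : ZMod p) :
    (derivative (derivative
      ((kloostermanPoly p α β).map (Int.castRingHom (ZMod p))))).eval 1 = -(2 * α * β) := by
  simp only [kloostermanPoly, Polynomial.map_sum, Polynomial.map_pow, map_X, derivative_sum,
    derivative_X_pow, derivative_C_mul, eval_finsetSum, eval_mul, eval_C, eval_pow, eval_X,
    one_pow, mul_one, ZMod.natCast_zmod_val, ZMod.mul_natCast_val_sub_one,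
    Finset.sum_sub_distrib, sum_units_linear h5, sum_units_square h5, sub_zero]

theorem unitKloosterman_prime_ne_zero {p : ℕ} [hp : Fact p.Prime] (α β : ZMod p) :
    unitKloosterman p α β ≠ 0 := by
  intro h
  have h1 := aeval_kloostermanPoly (n := p) (c := p) (k := 1) (mul_one p).symm 1 α β
  simp only [pow_one, Nat.cast_one, one_mul, h, expand_one] at h1
  obtain ⟨H, hH⟩ := X_sub_one_pow_dvd_map h1
  have h2 := eval_one_map_kloostermanPoly α β
  have : p - 1 ≠ 0 := by have := hp.out.two_le; omega
  rw [hH] at h2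
  simp [this] at h2

/-- The second derivative at 1 of the difference of products is `-6(αβ - α'β')` modulo `p`, with `6
= 2(2² - 1)` from the doubled arguments. It vanishes because `(X - 1)³` divides the difference, and
6 is invertible for `p ≥ 5`. -/
theorem mul_eq_mul_of_unitKloosterman_proportional {p : ℕ} [hp : Fact p.Prime] (h5 : 5 ≤ p)
    {α β α' β' : ZMod p}
    (h : unitKloosterman p α β * unitKloosterman p (2 * α') (2 * β') =
      unitKloosterman p α' β' * unitKloosterman p (2 * α) (2 * β)) : α * β = α' * β' := by
  have key : ∀ α β : ZMod p, aeval (Complex.exp (2 * Real.pi * Complex.I / p))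
      (kloostermanPoly p α β) = unitKloosterman p α β := by
    intro α β
    have h1 := aeval_kloostermanPoly (n := p) (c := p) (k := 1) (mul_one p).symm 1 α β
    simpa using h1
  have h0 : aeval (Complex.exp (2 * Real.pi * Complex.I / p))
      (kloostermanPoly p α β * kloostermanPoly p (2 * α') (2 * β') -
        kloostermanPoly p α' β' * kloostermanPoly p (2 * α) (2 * β)) = 0 := by
    simp only [map_sub, map_mul, key, h, sub_self]
  obtain ⟨H, hH⟩ := (pow_dvd_pow _ (by omega : 3 ≤ p - 1)).trans (X_sub_one_pow_dvd_map h0)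
  have h1 := congrArg (fun P => (derivative (derivative P)).eval 1) hH
  simp only [Polynomial.map_sub, Polynomial.map_mul, derivative_sub, derivative_mul,
    derivative_add, eval_sub, eval_add, eval_mul, eval_one_map_kloostermanPoly,
    eval_one_derivative_map_kloostermanPoly h5,
    eval_one_derivative_derivative_map_kloostermanPoly h5, derivative_pow, derivative_X,
    derivative_one, eval_pow, eval_X, eval_one, eval_C] at h1
  norm_num at h1
  have h2 : (6 : ZMod p) * (α * β - α' * β') = 0 := by linear_combination -h1
  have h6 : (6 : ZMod p) ≠ 0 := by
    intro h6
    have : (p : ℕ) ∣ 6 := (ZMod.natCast_eq_zero_iff 6 p).1 (by exact_mod_cast h6)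
    have h7 : p ∣ 2 * 3 := this
    rcases (hp.out.dvd_mul).1 h7 with h | h <;> have := Nat.le_of_dvd (by norm_num) h <;> omega
  exact sub_eq_zero.1 ((mul_eq_zero.1 h2).resolve_left h6)

/-! ### Twisted multiplicativity and non-vanishing -/

/-- With `r` inverse to `n` modulo `m` and `s` inverse to `m` modulo `n`, one has `rn + sm ≡ 1 mod
mn`, hence `j/(mn) ≡ rj/m + sj/n` modulo 1. -/
theorem stdAddChar_mul_intCast {m n : ℕ} [NeZero m] [NeZero n] (h : m.Coprime n) (j : ℤ) :
    ZMod.stdAddChar (j : ZMod (m * n)) =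
      ZMod.stdAddChar ((n : ZMod m)⁻¹ * (j : ZMod m)) *
        ZMod.stdAddChar ((m : ZMod n)⁻¹ * (j : ZMod n)) := by
  set r : ℤ := (((n : ZMod m)⁻¹).val : ℤ) with hr
  set s : ℤ := (((m : ZMod n)⁻¹).val : ℤ) with hs
  have hr' : (n : ZMod m)⁻¹ = (r : ZMod m) := by simp [hr]
  have hs' : (m : ZMod n)⁻¹ = (s : ZMod n) := by simp [hs]
  have h1 : (m : ℤ) ∣ r * n + s * m - 1 := by
    rw [← ZMod.intCast_zmod_eq_zero_iff_dvd]
    push_cast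
    rw [← hr', mul_comm, ZMod.coe_mul_inv_eq_one n h.symm]
    simp
  have h2 : (n : ℤ) ∣ r * n + s * m - 1 := by
    rw [← ZMod.intCast_zmod_eq_zero_iff_dvd]
    push_cast
    rw [← hs', mul_comm (m : ZMod n)⁻¹, ZMod.coe_mul_inv_eq_one m h]
    simp
  have h3 : ((m * n : ℕ) : ℤ) ∣ r * n + s * m - 1 := by
    push_cast
    exact (Nat.isCoprime_iff_coprime.2 h).mul_dvd h1 h2
  have h4 : (j : ZMod (m * n)) = ((j * (r * n + s * m) : ℤ) : ZMod (m * n)) := by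
    have := (ZMod.intCast_zmod_eq_zero_iff_dvd _ (m * n)).2 h3
    push_cast at this ⊢
    linear_combination (-(j : ZMod (m * n))) * this
  have h5 : (n : ZMod m)⁻¹ * j = ((r * j : ℤ) : ZMod m) := by rw [hr']; push_cast; ring
  have h6 : (m : ZMod n)⁻¹ * j = ((s * j : ℤ) : ZMod n) := by rw [hs']; push_cast; ring
  rw [h4, h5, h6, ZMod.stdAddChar_coe, ZMod.stdAddChar_coe, ZMod.stdAddChar_coe, ← Complex.exp_add]
  congr 1
  have hm : (m : ℂ) ≠ 0 := by exact_mod_cast NeZero.ne m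
  have hn : (n : ℂ) ≠ 0 := by exact_mod_cast NeZero.ne n
  push_cast
  field_simp

/-- Twisted multiplicativity of Kloosterman sums. -/
theorem unitKloosterman_mul {m n : ℕ} [NeZero m] [NeZero n] (h : m.Coprime n) (a b : ℤ) :
    unitKloosterman (m * n) a b =
      unitKloosterman m ((n : ZMod m)⁻¹ * a) ((n : ZMod m)⁻¹ * b) *
        unitKloosterman n ((m : ZMod n)⁻¹ * a) ((m : ZMod n)⁻¹ * b) := by
  let e : (ZMod (m * n))ˣ ≃* (ZMod m)ˣ × (ZMod n)ˣ :=
    (Units.mapEquiv (ZMod.chineseRemainder h).toMulEquiv).trans MulEquiv.prodUnits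
  have e1 : ∀ (u : (ZMod (m * n))ˣ) (j : ℤ), (j : ZMod (m * n)) = u → ((e u).1 : ZMod m) = j := by
    intro u j hj
    have : ((e u).1 : ZMod m) = (ZMod.chineseRemainder h (u : ZMod (m * n))).1 := rfl
    rw [this, ← hj, map_intCast]
    rfl
  have e2 : ∀ (u : (ZMod (m * n))ˣ) (j : ℤ), (j : ZMod (m * n)) = u → ((e u).2 : ZMod n) = j := by
    intro u j hj
    have : ((e u).2 : ZMod n) = (ZMod.chineseRemainder h (u : ZMod (m * n))).2 := rfl
    rw [this, ← hj, map_intCast]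
    rfl
  unfold unitKloosterman
  rw [Finset.sum_mul_sum, ← Finset.sum_product', Finset.univ_product_univ]
  refine Fintype.sum_equiv e.toEquiv _ _ fun u => ?_
  obtain ⟨i, hi⟩ := ZMod.intCast_surjective (u : ZMod (m * n))
  obtain ⟨j, hj⟩ := ZMod.intCast_surjective ((u⁻¹ : (ZMod (m * n))ˣ) : ZMod (m * n))
  have h1 : (e.toEquiv u) = e u := rfl
  rw [h1, ← Prod.fst_inv, ← Prod.snd_inv, ← map_inv, e1 u i hi, e2 u i hi, e1 _ j hj, e2 _ j hj,
    ← hi, ← hj]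
  have h2 : (a : ZMod (m * n)) * i + b * j = ((a * i + b * j : ℤ) : ZMod (m * n)) := by push_cast; rfl
  rw [h2, stdAddChar_mul_intCast h]
  congr 2 <;> (push_cast; ring)

theorem unitKloosterman_ne_zero_of_squarefree (n : ℕ) [hz : NeZero n] (hn : Squarefree n)
    (α β : ZMod n) : unitKloosterman n α β ≠ 0 := by
  induction n using Nat.strong_induction_on generalizing hz with
  | _ n ih =>
    by_cases h1 : n = 1
    · subst h1
      have h : ∀ x : ZMod 1, x = 0 := fun x => Subsingleton.elim _ _
      simp [unitKloosterman, h]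
    · have hp := Nat.minFac_prime h1
      obtain ⟨m, hm⟩ := Nat.minFac_dvd n
      generalize n.minFac = p at hp hm
      subst hm
      have hm0 : m ≠ 0 := right_ne_zero_of_mul (NeZero.ne (p * m))
      have : Fact p.Prime := ⟨hp⟩
      have : NeZero m := ⟨hm0⟩
      obtain ⟨a, rfl⟩ := ZMod.intCast_surjective α
      obtain ⟨b, rfl⟩ := ZMod.intCast_surjective β
      rw [unitKloosterman_mul (Nat.coprime_of_squarefree_mul hn)]
      refine mul_ne_zero (unitKloosterman_prime_ne_zero _ _) (ih m ?_ hn.of_mul_right _ _)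
      exact lt_mul_of_one_lt_left (Nat.pos_of_ne_zero hm0) hp.one_lt

/-! ### Rectangles of solutions -/

/-- To be used with `k = qm` and `k' = qm'`. Twisted multiplicativity puts the arguments `a/m, b/m`
on the factor of modulus `p`, so the invariant `αβ` is `ab/m²`. -/
theorem mul_inv_sq_eq_of_unitKloosterman_rectangle {p : ℕ} [hp : Fact p.Prime] (h5 : 5 ≤ p)
    (a b : ℤ) {m m' k k' : ℕ} [NeZero m] [NeZero m'] [NeZero k] [NeZero k']
    (hm : p.Coprime m) (hm' : p.Coprime m') (hk : p.Coprime k) (hk' : p.Coprime k')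
    (zm : ∀ α β, unitKloosterman m α β ≠ 0) (zm' : ∀ α β, unitKloosterman m' α β ≠ 0)
    (zk : unitKloosterman k a b ≠ 0) (zk' : unitKloosterman k' a b ≠ 0)
    (h : unitKloosterman (p * m) a b * unitKloosterman k' a b =
      unitKloosterman (p * m') a b * unitKloosterman k a b) :
    (a * b : ZMod p) * (m : ZMod p)⁻¹ ^ 2 = a * b * (m' : ZMod p)⁻¹ ^ 2 := by
  set N := m * m' * k * k' with hN
  have hpN : p.Coprime N := ((hm.mul_right hm').mul_right hk).mul_right hk'
  -- The automorphism attached to `t` doubles the arguments modulo `p` and fixes every sum whose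
  -- modulus divides `N`.
  obtain ⟨t, ht1, ht2⟩ := Nat.chineseRemainder hpN 2 1
  have htp : (t : ZMod p) = 2 := by
    have := (ZMod.natCast_eq_natCast_iff _ _ _).2 ht1
    simpa using this
  have htd : ∀ d : ℕ, d ∣ N → (t : ZMod d) = 1 := by
    intro d hd
    have := (ZMod.natCast_eq_natCast_iff _ _ _).2 (ht2.of_dvd hd)
    simpa using this
  have hcop : t.Coprime (p * N) := by
    refine Nat.Coprime.mul_right ?_ ?_
    · have h2 : Nat.gcd p t = Nat.gcd p 2 := by
        rw [Nat.gcd_comm, Nat.gcd_comm p 2]; exact ht1.gcd_eq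
      rw [Nat.coprime_comm, Nat.Coprime, h2]
      exact (Nat.coprime_primes hp.out Nat.prime_two).2 (by omega)
    · rw [Nat.Coprime, ht2.gcd_eq, Nat.gcd_one_left]
  have hN0 : N ≠ 0 := by simp [hN, NeZero.ne]
  have : NeZero N := ⟨hN0⟩
  set ζ := Complex.exp (2 * Real.pi * Complex.I / (p * N : ℕ))
  have ep := fun s => aeval_kloostermanPoly (n := p * N) (c := p) (k := N) rfl s
  have em := fun s => aeval_kloostermanPoly (n := p * N) (c := m) (k := p * m' * k * k')
    (by rw [hN]; ring) s
  have em' := fun s => aeval_kloostermanPoly (n := p * N) (c := m') (k := p * m * k * k')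
    (by rw [hN]; ring) s
  have ek := fun s => aeval_kloostermanPoly (n := p * N) (c := k) (k := p * m * m' * k')
    (by rw [hN]; ring) s
  have ek' := fun s => aeval_kloostermanPoly (n := p * N) (c := k') (k := p * m * m' * k)
    (by rw [hN]; ring) s
  rw [unitKloosterman_mul hm, unitKloosterman_mul hm'] at h
  set α := (m : ZMod p)⁻¹ * a
  set β := (m : ZMod p)⁻¹ * b
  set α' := (m' : ZMod p)⁻¹ * a
  set β' := (m' : ZMod p)⁻¹ * b
  set γ := (p : ZMod m)⁻¹ * a
  set δ := (p : ZMod m)⁻¹ * b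
  set γ' := (p : ZMod m')⁻¹ * a
  set δ' := (p : ZMod m')⁻¹ * b
  let G : ℤ[X] := expand ℤ N (kloostermanPoly p α β) *
      expand ℤ (p * m' * k * k') (kloostermanPoly m γ δ) *
      expand ℤ (p * m * m' * k) (kloostermanPoly k' a b) -
    expand ℤ N (kloostermanPoly p α' β') *
      expand ℤ (p * m * k * k') (kloostermanPoly m' γ' δ') *
      expand ℤ (p * m * m' * k') (kloostermanPoly k a b)
  have eG : ∀ s : ℕ, aeval (ζ ^ s) G =
      unitKloosterman p (s * α) (s * β) * unitKloosterman m (s * γ) (s * δ) *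
        unitKloosterman k' (s * a) (s * b) -
      unitKloosterman p (s * α') (s * β') * unitKloosterman m' (s * γ') (s * δ') *
        unitKloosterman k (s * a) (s * b) := by
    intro s
    simp only [G, map_sub, map_mul, ζ, ep, em, em', ek, ek']
  have g1 : aeval ζ G = 0 := by
    have := eG 1
    simp only [pow_one, Nat.cast_one, one_mul] at this
    rw [this, h, sub_self]
  have g2 := aeval_pow_eq_zero_of_coprime hcop g1
  rw [eG t, htp, htd m ⟨m' * k * k', by rw [hN]; ring⟩, htd m' ⟨m * k * k', by rw [hN]; ring⟩,
    htd k ⟨m * m' * k', by rw [hN]; ring⟩, htd k' ⟨m * m' * k, by rw [hN]; ring⟩] at g2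
  simp only [one_mul] at g2
  set V := unitKloosterman m γ δ with hV
  set V' := unitKloosterman m' γ' δ' with hV'
  have zV : V ≠ 0 := zm _ _
  have zV' : V' ≠ 0 := zm' _ _
  -- The factors of modulus `m, m', k, k'` are the same in the relation and in its conjugate; being
  -- nonzero, they cancel.
  have key : unitKloosterman p α β * unitKloosterman p (2 * α') (2 * β') =
      unitKloosterman p α' β' * unitKloosterman p (2 * α) (2 * β) := by
    have hne : V * unitKloosterman k' a b * (V' * unitKloosterman k a b) ≠ 0 :=
      mul_ne_zero (mul_ne_zero zV zk') (mul_ne_zero zV' zk)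
    apply mul_right_cancel₀ hne
    linear_combination (unitKloosterman p (2 * α') (2 * β') * V' * unitKloosterman k a b) * h -
      (unitKloosterman p α' β' * V' * unitKloosterman k a b) * g2
  have := mul_eq_mul_of_unitKloosterman_proportional h5 key
  simp only [α, β, α', β'] at this
  linear_combination this

theorem natCast_sq_eq_of_kloostermanSum_rectangle {p q m m' : ℕ} (hp : p.Prime) (hq : q.Prime)
    (hpq : p ≠ q) (h5 : 5 ≤ p) {a b : ℤ} (ha : ¬ (p : ℤ) ∣ a) (hb : ¬ (p : ℤ) ∣ b)
    (h1 : Squarefree (p * m)) (h2 : Squarefree (p * m')) (h3 : Squarefree (q * m))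
    (h4 : Squarefree (q * m'))
    (h : kloostermanSum a b (p * m) * kloostermanSum a b (q * m') =
      kloostermanSum a b (p * m') * kloostermanSum a b (q * m)) :
    (p : ℤ) ∣ (m : ℤ) ^ 2 - (m' : ℤ) ^ 2 := by
  have : Fact p.Prime := ⟨hp⟩
  have : NeZero q := ⟨hq.ne_zero⟩
  have hsm : Squarefree m := h1.of_mul_right
  have hsm' : Squarefree m' := h2.of_mul_right
  have : NeZero m := ⟨hsm.ne_zero⟩
  have : NeZero m' := ⟨hsm'.ne_zero⟩
  have cm : p.Coprime m := Nat.coprime_of_squarefree_mul h1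
  have cm' : p.Coprime m' := Nat.coprime_of_squarefree_mul h2
  have cq : p.Coprime q := (Nat.coprime_primes hp hq).2 hpq
  have zm : (m : ZMod p) ≠ 0 := fun h0 =>
    hp.coprime_iff_not_dvd.1 cm ((ZMod.natCast_eq_zero_iff _ _).1 h0)
  have zm' : (m' : ZMod p) ≠ 0 := fun h0 =>
    hp.coprime_iff_not_dvd.1 cm' ((ZMod.natCast_eq_zero_iff _ _).1 h0)
  have za : (a : ZMod p) ≠ 0 := fun h0 => ha ((ZMod.intCast_zmod_eq_zero_iff_dvd _ _).1 h0)
  have zb : (b : ZMod p) ≠ 0 := fun h0 => hb ((ZMod.intCast_zmod_eq_zero_iff_dvd _ _).1 h0)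
  simp only [kloostermanSum_eq_unitKloosterman] at h
  have key := mul_inv_sq_eq_of_unitKloosterman_rectangle h5 a b cm cm' (cq.mul_right cm)
    (cq.mul_right cm') (unitKloosterman_ne_zero_of_squarefree m hsm)
    (unitKloosterman_ne_zero_of_squarefree m' hsm')
    (unitKloosterman_ne_zero_of_squarefree _ h3 _ _)
    (unitKloosterman_ne_zero_of_squarefree _ h4 _ _) h
  have key2 := mul_left_cancel₀ (mul_ne_zero za zb) key
  rw [← ZMod.intCast_zmod_eq_zero_iff_dvd]
  push_cast
  field_simp at key2
  rw [key2, sub_self]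

/-! ### A weighted Kővári–Sós–Turán bound -/

/-- The sum of `m^(-3/4)`, by telescoping `4 m^(1/4)`; nested square roots keep all exponents
integral. -/
theorem sum_Icc_inv_sqrt_sqrt_cube_le (M : ℕ) :
    ∑ m ∈ Finset.Icc 1 M, (√√(m : ℝ) ^ 3)⁻¹ ≤ 4 * √√(M : ℝ) := by
  induction M with
  | zero => simp
  | succ M ih =>
    rw [Finset.sum_Icc_succ_top (by omega)]
    set r := √√((M + 1 : ℕ) : ℝ)
    set s := √√(M : ℝ)
    have hs : 0 ≤ s := Real.sqrt_nonneg _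
    have hr : 0 < r := Real.sqrt_pos.2 (Real.sqrt_pos.2 (by positivity))
    have hsr : s ≤ r := Real.sqrt_le_sqrt (Real.sqrt_le_sqrt (by push_cast; linarith))
    have r4 : r ^ 4 = M + 1 := by
      have : r ^ 4 = (r ^ 2) ^ 2 := by ring
      rw [this, Real.sq_sqrt (Real.sqrt_nonneg _), Real.sq_sqrt (by positivity)]
      push_cast; rfl
    have s4 : s ^ 4 = M := by
      have : s ^ 4 = (s ^ 2) ^ 2 := by ring
      rw [this, Real.sq_sqrt (Real.sqrt_nonneg _), Real.sq_sqrt (by positivity)]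
    have h1 : 1 ≤ (r - s) * (4 * r ^ 3) := by
      have h2 : (r - s) * (r ^ 3 + r ^ 2 * s + r * s ^ 2 + s ^ 3) = 1 := by
        linear_combination r4 - s4
      have h3 : r ^ 3 + r ^ 2 * s + r * s ^ 2 + s ^ 3 ≤ 4 * r ^ 3 := by
        have e1 : r ^ 2 * s ≤ r ^ 2 * r := by gcongr
        have e2 : r * s ^ 2 ≤ r * r ^ 2 := by gcongr
        have e3 : s ^ 3 ≤ r ^ 3 := by gcongr
        nlinarith
      calc 1 = _ := h2.symm
        _ ≤ _ := mul_le_mul_of_nonneg_left h3 (sub_nonneg.2 hsr)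
    have h4 : (r ^ 3)⁻¹ ≤ 4 * (r - s) := by
      rw [inv_le_iff_one_le_mul₀ (by positivity)]
      linarith
    linarith

theorem sum_Ioc_inv_mul_sqrt_le {Y : ℕ} (hY : 1 ≤ Y) (K : ℕ) (hK : Y ≤ K) :
    ∑ p ∈ Finset.Ioc Y K, ((p : ℝ) * √(p : ℝ))⁻¹ ≤ 2 / √(Y : ℝ) - 2 / √(K : ℝ) := by
  induction K, hK using Nat.le_induction with
  | base => simp
  | succ K hK ih =>
    rw [Finset.sum_Ioc_succ_top (by omega)]
    have hK1 : (1 : ℝ) ≤ K := by exact_mod_cast hY.trans hK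
    set r := √((K + 1 : ℕ) : ℝ)
    set s := √(K : ℝ)
    have hs : 0 < s := Real.sqrt_pos.2 (by linarith)
    have hr : 0 < r := Real.sqrt_pos.2 (by positivity)
    have hsr : s ≤ r := Real.sqrt_le_sqrt (by push_cast; linarith)
    have r2 : r ^ 2 = ((K + 1 : ℕ) : ℝ) := Real.sq_sqrt (by positivity)
    have s2 : s ^ 2 = (K : ℝ) := Real.sq_sqrt (by positivity)
    have hrs : r ^ 2 = s ^ 2 + 1 := by rw [r2, s2]; push_cast; rfl
    have h : (((K + 1 : ℕ) : ℝ) * r)⁻¹ ≤ 2 / s - 2 / r := by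
      rw [← r2, div_sub_div _ _ hs.ne' hr.ne', inv_eq_one_div,
        div_le_div_iff₀ (by positivity) (by positivity)]
      have h1 : (r - s) * (r + s) = 1 := by linear_combination hrs
      have h2 : (r - s) * (r + s) ≤ (r - s) * (2 * r) :=
        mul_le_mul_of_nonneg_left (by linarith) (sub_nonneg.2 hsr)
      have h3 : s * r ≤ r ^ 2 := by nlinarith
      have h4 : s * r * 1 ≤ r ^ 2 * ((r - s) * (2 * r)) := by
        apply mul_le_mul h3 (by linarith) zero_le_one (by positivity)
      linarith
    linarith

/-- If `d > 1 + s`, then `d - 1 > s` and the last term alone exceeds `d`. A degree is thus charged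
to one free edge, a weight `s`, and ordered pairs of neighbours. -/
theorem natCast_le_one_add_add_div (d : ℕ) {s : ℝ} (hs : 0 < s) :
    (d : ℝ) ≤ 1 + s + ((d * d - d : ℕ) : ℝ) / s := by
  have h : ((d * d - d : ℕ) : ℝ) = d * (d - 1) := by
    rw [Nat.cast_sub (Nat.le_mul_self d)]; push_cast; ring
  rw [h]
  rcases le_or_gt (d : ℝ) (1 + s) with h1 | h1
  · have : 0 ≤ (d : ℝ) * (d - 1) := by
      rw [← h]; positivity
    have : 0 ≤ (d : ℝ) * (d - 1) / s := by positivity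
    linarith
  · have : (d : ℝ) ≤ d * (d - 1) / s := by
      rw [le_div_iff₀ hs]
      have : (0 : ℝ) ≤ d := by positivity
      nlinarith
    linarith

/-- A weighted Kővári–Sós–Turán bound for the number of products `p * m ≤ X` in a bipartite graph in
which two distinct integers `m`, `m'` have at most `t` common neighbours `p`. -/
theorem sum_card_le_of_card_common_le {X t : ℝ} {Y : ℕ} (hX : 1 ≤ X) (hY : 1 ≤ Y) (ht : 0 ≤ t)
    (P : Finset ℕ) (A : ℕ → Finset ℕ) (hP : ∀ p ∈ P, Y < p ∧ (p : ℝ) ≤ X)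
    (hA : ∀ p ∈ P, ∀ m ∈ A p, 1 ≤ m ∧ (p : ℝ) * m ≤ X)
    (hcommon : ∀ m m', m ≠ m' → ((P.filter fun p => m ∈ A p ∧ m' ∈ A p).card : ℝ) ≤ t) :
    ∑ p ∈ P, ((A p).card : ℝ) ≤ P.card + (2 + 16 * t) * (X / √(Y : ℝ)) := by
  have hX0 : 0 < X := by linarith
  have hY0 : (0 : ℝ) < Y := by exact_mod_cast hY
  -- The weight `s p = X p^(-3/2)` is summable beyond `Y`, while its inverse can still be split
  -- between the two neighbours.
  set s : ℕ → ℝ := fun p => X * ((p : ℝ) * √(p : ℝ))⁻¹ with hs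
  set h : ℕ → ℝ := fun m => (√√(m : ℝ) ^ 3)⁻¹ with hh
  set I := Finset.Icc 1 ⌊X / Y⌋₊ with hI
  have hp0 : ∀ p ∈ P, (0 : ℝ) < p := fun p hp => by
    have := (hP p hp).1
    exact_mod_cast (by omega : 0 < p)
  have hspos : ∀ p ∈ P, 0 < s p := fun p hp => by
    have := hp0 p hp
    simp only [hs]; positivity
  have hsum : ∑ p ∈ P, s p ≤ 2 * (X / √(Y : ℝ)) := by
    have hsub : P ⊆ Finset.Ioc Y (max Y ⌊X⌋₊) := fun p hp => by
      rw [Finset.mem_Ioc]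
      exact ⟨(hP p hp).1, le_max_of_le_right (Nat.le_floor (hP p hp).2)⟩
    calc ∑ p ∈ P, s p ≤ ∑ p ∈ Finset.Ioc Y (max Y ⌊X⌋₊), s p :=
          Finset.sum_le_sum_of_subset_of_nonneg hsub fun p _ _ => by simp only [hs]; positivity
      _ = X * ∑ p ∈ Finset.Ioc Y (max Y ⌊X⌋₊), ((p : ℝ) * √(p : ℝ))⁻¹ := by
          rw [Finset.mul_sum]
      _ ≤ X * (2 / √(Y : ℝ)) := by
          have h1 := sum_Ioc_inv_mul_sqrt_le hY _ (le_max_left Y ⌊X⌋₊)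
          have h2 : (0 : ℝ) ≤ 2 / √((max Y ⌊X⌋₊ : ℕ) : ℝ) := by positivity
          exact mul_le_mul_of_nonneg_left (by linarith) hX0.le
      _ = _ := by ring
  have hmem : ∀ p ∈ P, ∀ m ∈ A p, m ∈ I := fun p hp m hm => by
    obtain ⟨h1, h2⟩ := hA p hp m hm
    rw [hI, Finset.mem_Icc]
    refine ⟨h1, Nat.le_floor ?_⟩
    rw [le_div_iff₀ hY0]
    have : (Y : ℝ) ≤ p := by exact_mod_cast (hP p hp).1.le
    nlinarith [(by positivity : (0 : ℝ) ≤ m)]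
  -- From `p ≤ X/m` and `p ≤ X/m'`: `p^(3/2) ≤ (X/m)^(3/4) (X/m')^(3/4)`. The proof writes this in
  -- fourth roots.
  have hw : ∀ p ∈ P, ∀ x ∈ (A p).offDiag, (s p)⁻¹ ≤ √X * (h x.1 * h x.2) := by
    intro p hp x hx
    rw [Finset.mem_offDiag] at hx
    obtain ⟨m1, b1⟩ := hA p hp _ hx.1
    obtain ⟨m2, b2⟩ := hA p hp _ hx.2.1
    have q0 := hp0 p hp
    have q1 : (0 : ℝ) < x.1 := by exact_mod_cast m1
    have q2 : (0 : ℝ) < x.2 := by exact_mod_cast m2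
    have c1 : √√(p : ℝ) * √√(x.1 : ℝ) ≤ √√X := by
      rw [← Real.sqrt_mul (Real.sqrt_nonneg _), ← Real.sqrt_mul q0.le]
      exact Real.sqrt_le_sqrt (Real.sqrt_le_sqrt b1)
    have c2 : √√(p : ℝ) * √√(x.2 : ℝ) ≤ √√X := by
      rw [← Real.sqrt_mul (Real.sqrt_nonneg _), ← Real.sqrt_mul q0.le]
      exact Real.sqrt_le_sqrt (Real.sqrt_le_sqrt b2)
    have rp : 0 < √√(p : ℝ) := Real.sqrt_pos.2 (Real.sqrt_pos.2 q0)
    have r1 : 0 < √√(x.1 : ℝ) := Real.sqrt_pos.2 (Real.sqrt_pos.2 q1)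
    have r2 : 0 < √√(x.2 : ℝ) := Real.sqrt_pos.2 (Real.sqrt_pos.2 q2)
    have rX : 0 < √√X := Real.sqrt_pos.2 (Real.sqrt_pos.2 hX0)
    have ep : (p : ℝ) * √(p : ℝ) = √√(p : ℝ) ^ 6 := by
      have e1 : √√(p : ℝ) ^ 6 = (√√(p : ℝ) ^ 2) ^ 2 * √√(p : ℝ) ^ 2 := by ring
      rw [e1, Real.sq_sqrt (Real.sqrt_nonneg _), Real.sq_sqrt q0.le]
    have eX1 : √X = √√X ^ 2 := (Real.sq_sqrt (Real.sqrt_nonneg _)).symm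
    have eX : X = √√X ^ 4 := by
      have e1 : √√X ^ 4 = (√√X ^ 2) ^ 2 := by ring
      rw [e1, Real.sq_sqrt (Real.sqrt_nonneg _), Real.sq_sqrt hX0.le]
    have c3 : (√√(p : ℝ) * √√(x.1 : ℝ)) ^ 3 * (√√(p : ℝ) * √√(x.2 : ℝ)) ^ 3 ≤
        √√X ^ 3 * √√X ^ 3 := by gcongr
    simp only [hs, hh, ep]
    generalize √√(p : ℝ) = u at *
    generalize √√(x.1 : ℝ) = v at *
    generalize √√(x.2 : ℝ) = w at *
    rw [eX1]
    generalize √√X = z at *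
    rw [eX, mul_inv, inv_inv, ← mul_inv, ← div_eq_mul_inv, inv_mul_eq_div,
      div_le_div_iff₀ (by positivity) (by positivity)]
    linarith
  have hoff : ∑ p ∈ P, (((A p).card * (A p).card - (A p).card : ℕ) : ℝ) / s p ≤
      16 * t * (X / √(Y : ℝ)) := by
    calc ∑ p ∈ P, (((A p).card * (A p).card - (A p).card : ℕ) : ℝ) / s p
        = ∑ p ∈ P, ∑ x ∈ (A p).offDiag, (s p)⁻¹ := by
          refine Finset.sum_congr rfl fun p _ => ?_
          rw [Finset.sum_const, Finset.offDiag_card, nsmul_eq_mul, div_eq_mul_inv]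
      _ ≤ ∑ p ∈ P, ∑ x ∈ (A p).offDiag, √X * (h x.1 * h x.2) :=
          Finset.sum_le_sum fun p hp => Finset.sum_le_sum fun x hx => hw p hp x hx
      _ = ∑ x ∈ I ×ˢ I, ∑ p ∈ P.filter (fun p => x ∈ (A p).offDiag), √X * (h x.1 * h x.2) := by
          refine Finset.sum_comm' fun p x => ?_
          simp only [Finset.mem_filter, Finset.mem_product, Finset.mem_offDiag]
          constructor
          · rintro ⟨hp, h1, h2, h3⟩
            exact ⟨⟨hp, h1, h2, h3⟩, hmem p hp _ h1, hmem p hp _ h2⟩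
          · rintro ⟨h1, _⟩
            exact h1
      _ ≤ ∑ x ∈ I ×ˢ I, t * (√X * (h x.1 * h x.2)) := by
          refine Finset.sum_le_sum fun x _ => ?_
          rw [Finset.sum_const, nsmul_eq_mul]
          refine mul_le_mul_of_nonneg_right ?_ (by simp only [hh]; positivity)
          by_cases hx : x.1 = x.2
          · simpa [Finset.mem_offDiag, hx] using ht
          · refine le_trans ?_ (hcommon x.1 x.2 hx)
            norm_cast
            refine Finset.card_le_card fun p hp => ?_
            simp only [Finset.mem_filter, Finset.mem_offDiag] at hp ⊢
            exact ⟨hp.1, hp.2.1, hp.2.2.1⟩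
      _ = t * √X * ((∑ m ∈ I, h m) * ∑ m ∈ I, h m) := by
          rw [Finset.sum_mul_sum, ← Finset.sum_product', Finset.mul_sum]
          exact Finset.sum_congr rfl fun x _ => by ring
      _ ≤ t * √X * ((4 * √√(X / Y)) * (4 * √√(X / Y))) := by
          have h1 : ∑ m ∈ I, h m ≤ 4 * √√(X / Y) :=
            (sum_Icc_inv_sqrt_sqrt_cube_le _).trans (mul_le_mul_of_nonneg_left
              (Real.sqrt_le_sqrt (Real.sqrt_le_sqrt (Nat.floor_le (by positivity)))) (by norm_num))
          have h0 : 0 ≤ ∑ m ∈ I, h m := Finset.sum_nonneg fun m _ => by simp only [hh]; positivity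
          gcongr
      _ = 16 * t * (X / √(Y : ℝ)) := by
          have e1 : (4 * √√(X / Y)) * (4 * √√(X / Y)) = 16 * (√√(X / Y) * √√(X / Y)) := by ring
          have e2 : X = √X * √X := (Real.mul_self_sqrt hX0.le).symm
          rw [e1, Real.mul_self_sqrt (Real.sqrt_nonneg _), Real.sqrt_div hX0.le]
          nth_rw 3 [e2]
          ring
  calc ∑ p ∈ P, ((A p).card : ℝ)
      ≤ ∑ p ∈ P, (1 + s p + (((A p).card * (A p).card - (A p).card : ℕ) : ℝ) / s p) :=
        Finset.sum_le_sum fun p hp => natCast_le_one_add_add_div _ (hspos p hp)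
    _ = P.card + ∑ p ∈ P, s p + ∑ p ∈ P, (((A p).card * (A p).card - (A p).card : ℕ) : ℝ) / s p := by
        rw [Finset.sum_add_distrib, Finset.sum_add_distrib]
        simp
    _ ≤ _ := by linarith

/-! ### Square-free integers without large prime factors -/

/-- By the binomial theorem over subsets of the prime factors, the left side is the same sum
restricted to square-free divisors. -/
theorem add_one_pow_card_primeFactors_le_sum_divisors (T : ℕ) {n : ℕ} (hn : n ≠ 0) :
    (T + 1) ^ n.primeFactors.card ≤ ∑ d ∈ n.divisors, T ^ d.primeFactors.card := by
  have h1 := Finset.sum_pow_mul_eq_add_pow T 1 n.primeFactors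
  simp only [one_pow, mul_one] at h1
  rw [← h1]
  have hpf : ∀ s ∈ n.primeFactors.powerset, (∏ p ∈ s, p).primeFactors = s := fun s hs =>
    Nat.primeFactors_prod fun p hp => Nat.prime_of_mem_primeFactors (Finset.mem_powerset.1 hs hp)
  have hinj : Set.InjOn (fun s : Finset ℕ => ∏ p ∈ s, p) n.primeFactors.powerset := by
    intro s hs t ht hst
    rw [← hpf s hs, ← hpf t ht]
    exact congrArg Nat.primeFactors hst
  calc ∑ s ∈ n.primeFactors.powerset, T ^ s.card
      = ∑ s ∈ n.primeFactors.powerset, T ^ (∏ p ∈ s, p).primeFactors.card :=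
        Finset.sum_congr rfl fun s hs => by rw [hpf s hs]
    _ = ∑ d ∈ n.primeFactors.powerset.image (fun s => ∏ p ∈ s, p), T ^ d.primeFactors.card :=
        (Finset.sum_image (f := fun d : ℕ => T ^ d.primeFactors.card) hinj).symm
    _ ≤ _ := by
        refine Finset.sum_le_sum_of_subset fun d hd => ?_
        obtain ⟨s, hs, rfl⟩ := Finset.mem_image.1 hd
        rw [Nat.mem_divisors]
        exact ⟨(Finset.prod_dvd_prod_of_subset _ _ _ (Finset.mem_powerset.1 hs)).trans
          (Nat.prod_primeFactors_dvd n), hn⟩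

/-- Induction on `T`: each step splits `n` as a product of two factors and releases one more
harmonic sum. For `T = 0` only `n = 1` contributes, since `0^0 = 1`. -/
theorem sum_Icc_pow_card_primeFactors_div_le (T M : ℕ) :
    ∑ n ∈ Finset.Icc 1 M, (T : ℝ) ^ n.primeFactors.card / n ≤
      (∑ n ∈ Finset.Icc 1 M, (n : ℝ)⁻¹) ^ T := by
  induction T with
  | zero =>
    rw [pow_zero]
    have h : ∀ n ∈ Finset.Icc 1 M, ((0 : ℕ) : ℝ) ^ n.primeFactors.card / n =
        if n = 1 then 1 else 0 := by
      intro n hn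
      have hn1 := (Finset.mem_Icc.1 hn).1
      split_ifs with h1
      · simp [h1]
      · have : n.primeFactors.card ≠ 0 := by
          rw [Finset.card_ne_zero, Nat.nonempty_primeFactors]; omega
        simp [this]
    rw [Finset.sum_congr rfl h, Finset.sum_ite_eq' ]
    split_ifs <;> norm_num
  | succ T ih =>
    set I := Finset.Icc 1 M
    calc ∑ n ∈ I, ((T + 1 : ℕ) : ℝ) ^ n.primeFactors.card / n
        ≤ ∑ n ∈ I, ∑ x ∈ (I ×ˢ I).filter (fun x => x.1 * x.2 = n),
            (T : ℝ) ^ x.1.primeFactors.card / x.1 * (x.2 : ℝ)⁻¹ := by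
          refine Finset.sum_le_sum fun n hn => ?_
          have hn1 := Finset.mem_Icc.1 hn
          have hn0 : n ≠ 0 := by omega
          have h1 : ((T + 1 : ℕ) : ℝ) ^ n.primeFactors.card ≤
              ∑ d ∈ n.divisors, (T : ℝ) ^ d.primeFactors.card := by
            exact_mod_cast add_one_pow_card_primeFactors_le_sum_divisors T hn0
          calc ((T + 1 : ℕ) : ℝ) ^ n.primeFactors.card / n
              ≤ (∑ d ∈ n.divisors, (T : ℝ) ^ d.primeFactors.card) / n := by gcongr
            _ = ∑ x ∈ n.divisorsAntidiagonal, (T : ℝ) ^ x.1.primeFactors.card / n := by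
                rw [Finset.sum_div, Nat.sum_divisorsAntidiagonal
                  (fun d _ => (T : ℝ) ^ d.primeFactors.card / n)]
            _ = ∑ x ∈ n.divisorsAntidiagonal,
                  (T : ℝ) ^ x.1.primeFactors.card / x.1 * (x.2 : ℝ)⁻¹ := by
                refine Finset.sum_congr rfl fun x hx => ?_
                rw [← (Nat.mem_divisorsAntidiagonal.1 hx).1]
                push_cast
                rw [div_mul_eq_div_div, div_eq_mul_inv _ (x.2 : ℝ)]
            _ ≤ _ := by
                refine Finset.sum_le_sum_of_subset_of_nonneg (fun x hx => ?_)
                  fun _ _ _ => by positivity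
                have hx' := Nat.mem_divisorsAntidiagonal.1 hx
                have x1 : x.1 ≠ 0 := by rintro h; simp [h] at hx'; omega
                have x2 : x.2 ≠ 0 := by rintro h; simp [h] at hx'; omega
                have l1 : x.1 ≤ n := Nat.le_of_dvd (by omega) ⟨x.2, hx'.1.symm⟩
                have l2 : x.2 ≤ n := Nat.le_of_dvd (by omega) ⟨x.1, by rw [mul_comm, hx'.1]⟩
                simp only [I, Finset.mem_filter, Finset.mem_product, Finset.mem_Icc]
                exact ⟨⟨⟨by omega, by omega⟩, by omega, by omega⟩, hx'.1⟩
      _ ≤ ∑ x ∈ I ×ˢ I, (T : ℝ) ^ x.1.primeFactors.card / x.1 * (x.2 : ℝ)⁻¹ :=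
          Finset.sum_fiberwise_le_sum_of_sum_fiber_nonneg fun _ _ =>
            Finset.sum_nonneg fun _ _ => by positivity
      _ = (∑ n ∈ I, (T : ℝ) ^ n.primeFactors.card / n) * ∑ n ∈ I, (n : ℝ)⁻¹ := by
          rw [Finset.sum_mul_sum, ← Finset.sum_product']
      _ ≤ _ := by
          rw [pow_succ]
          exact mul_le_mul_of_nonneg_right ih (Finset.sum_nonneg fun _ _ => by positivity)

theorem sum_Icc_inv_le_one_add_log {X : ℝ} (hX : 1 ≤ X) :
    ∑ n ∈ Finset.Icc 1 ⌊X⌋₊, (n : ℝ)⁻¹ ≤ 1 + Real.log X := by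
  have h := harmonic_le_one_add_log ⌊X⌋₊
  rw [harmonic_eq_sum_Icc] at h
  push_cast at h
  refine h.trans (add_le_add le_rfl (Real.log_le_log ?_ (Nat.floor_le (by linarith))))
  exact_mod_cast Nat.floor_pos.2 hX

/-- With `c = 2k + 1`, raise `1 + x ≤ c exp(x/c)` to the power `2k < c`. -/
theorem one_add_sq_pow_le_mul_exp (k : ℕ) {x : ℝ} (hx : 0 ≤ x) :
    (1 + x ^ 2) ^ k ≤ ((2 * k + 1 : ℕ) : ℝ) ^ (2 * k) * Real.exp x := by
  set c : ℝ := ((2 * k + 1 : ℕ) : ℝ) with hc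
  have hc1 : 1 ≤ c := by rw [hc]; exact_mod_cast Nat.le_add_left 1 (2 * k)
  have h1 : 1 + x ^ 2 ≤ (1 + x) ^ 2 := by nlinarith
  have h2 : 1 + x ≤ c * Real.exp (x / c) := by
    have := Real.add_one_le_exp (x / c)
    calc 1 + x ≤ c * (x / c + 1) := by
          field_simp
          linarith
      _ ≤ _ := by gcongr
  calc (1 + x ^ 2) ^ k ≤ ((1 + x) ^ 2) ^ k := by gcongr
    _ = (1 + x) ^ (2 * k) := by rw [pow_mul]
    _ ≤ (c * Real.exp (x / c)) ^ (2 * k) := by gcongr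
    _ = c ^ (2 * k) * Real.exp ((2 * k : ℕ) * (x / c)) := by
        rw [mul_pow, Real.exp_nat_mul]
    _ ≤ _ := by
        gcongr
        rw [← mul_div_assoc, div_le_iff₀ (by linarith), mul_comm]
        refine mul_le_mul_of_nonneg_left ?_ hx
        rw [hc]; exact_mod_cast Nat.le_succ (2 * k)

theorem sqrt_eq_exp_sqrt_log {X : ℝ} (hX : 1 ≤ X) :
    √X = Real.exp (√(Real.log X) ^ 2 / 2) := by
  rw [Real.sq_sqrt (Real.log_nonneg hX), Real.sqrt_eq_iff_mul_self_eq (by linarith)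
    (Real.exp_pos _).le, ← Real.exp_add, add_halves, Real.exp_log (by linarith)]

/-- From `L ≤ 1/2 + L²/2` and `exp(1/2) ≤ 2` one gets `exp L ≤ 2√X`. -/
theorem sqrt_le_two_mul_mul_exp_neg {X : ℝ} (hX : 1 ≤ X) :
    √X ≤ 2 * (X * Real.exp (-√(Real.log X))) := by
  set L := √(Real.log X)
  have h0 : √X = Real.exp (L ^ 2 / 2) := sqrt_eq_exp_sqrt_log hX
  have h1 : X = √X * √X := (Real.mul_self_sqrt (by linarith)).symm
  have h2 : Real.exp L ≤ 2 * √X := by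
    have h3 : Real.exp (1 / 2) ≤ 2 := by
      have := Real.exp_one_lt_d9
      have h4 : Real.exp (1 / 2) ^ 2 = Real.exp 1 := by
        rw [← Real.exp_nat_mul]; norm_num
      nlinarith [Real.exp_pos (1 / 2)]
    calc Real.exp L ≤ Real.exp (1 / 2 + L ^ 2 / 2) :=
          Real.exp_le_exp.2 (by nlinarith [sq_nonneg (L - 1)])
      _ = Real.exp (1 / 2) * √X := by rw [Real.exp_add, h0]
      _ ≤ _ := by gcongr
  rw [Real.exp_neg, ← mul_assoc, ← div_eq_mul_inv, le_div_iff₀ (Real.exp_pos _)]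
  calc √X * Real.exp L ≤ √X * (2 * √X) := by gcongr
    _ = 2 * (√X * √X) := by ring
    _ = 2 * X := by rw [← h1]

/-- A bound for the number of square-free integers up to `X` without prime factors exceeding
`exp (4 * √(log X))`. -/
theorem exists_card_squarefree_smooth_le : ∃ C : ℝ, 0 ≤ C ∧ ∀ X : ℝ, 1 ≤ X →
    (((Finset.Icc 1 ⌊X⌋₊).filter fun n => Squarefree n ∧
      ∀ p : ℕ, p ∈ n.primeFactors → (p : ℝ) ≤ Real.exp (4 * √(Real.log X))).card : ℝ) ≤
      C * (X * Real.exp (-√(Real.log X))) := by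
  -- The exponent 16 makes `T^ω(n) ≥ exp(2L)` as soon as `ω(n) ≥ L/8`.
  obtain ⟨T, hT⟩ := exists_nat_ge (Real.exp 16)
  refine ⟨2 + ((2 * T + 1 : ℕ) : ℝ) ^ (2 * T), by positivity, fun X hX => ?_⟩
  set L := √(Real.log X) with hL
  have hL0 : 0 ≤ L := Real.sqrt_nonneg _
  have hL2 : L ^ 2 = Real.log X := Real.sq_sqrt (Real.log_nonneg hX)
  set I := Finset.Icc 1 ⌊X⌋₊
  set B := I.filter fun n => Squarefree n ∧ ∀ p : ℕ, p ∈ n.primeFactors → (p : ℝ) ≤ Real.exp (4 * L)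
  -- If `n > √X = exp(L²/2)` and all its primes are at most `exp(4L)`, then `n ≤ exp(4L ω(n))`, so
  -- `ω(n) ≥ L/8`.
  have hsub : B ⊆ Finset.Icc 1 ⌊√X⌋₊ ∪ I.filter fun n => L / 8 ≤ n.primeFactors.card := by
    intro n hn
    simp only [B, Finset.mem_filter] at hn
    obtain ⟨hnI, hsq, hp⟩ := hn
    rw [Finset.mem_union, Finset.mem_filter, Finset.mem_Icc]
    by_cases h : (n : ℝ) ≤ √X
    · exact Or.inl ⟨(Finset.mem_Icc.1 hnI).1, Nat.le_floor h⟩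
    · refine Or.inr ⟨hnI, ?_⟩
      rw [not_le, sqrt_eq_exp_sqrt_log hX] at h
      have h1 : (n : ℝ) ≤ Real.exp (4 * L) ^ n.primeFactors.card := by
        rw [← Finset.prod_const]
        nth_rw 1 [← Nat.prod_primeFactors_of_squarefree hsq]
        push_cast
        exact Finset.prod_le_prod (fun _ _ => by positivity) hp
      rw [← Real.exp_nat_mul] at h1
      have h2 := Real.exp_lt_exp.1 (h.trans_le h1)
      rcases hL0.eq_or_lt with h0 | h0
      · rw [← h0]; simp
      · have : L * (L / 2) < L * (4 * n.primeFactors.card) := by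
          calc L * (L / 2) = L ^ 2 / 2 := by ring
            _ < _ := h2
            _ = _ := by ring
        have := lt_of_mul_lt_mul_left this hL0
        linarith
  -- Rankin's trick: each such `n` has weight `X exp(-2L) T^ω(n) / n ≥ 1`, and the sum of `T^ω(n)/n`
  -- is `O((1 + L²)^T)`, which costs only a factor `exp L`.
  have h2 : ((I.filter fun n => L / 8 ≤ n.primeFactors.card).card : ℝ) ≤
      ((2 * T + 1 : ℕ) : ℝ) ^ (2 * T) * (X * Real.exp (-L)) := by
    calc ((I.filter fun n => L / 8 ≤ n.primeFactors.card).card : ℝ)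
        = ∑ n ∈ I.filter fun n => L / 8 ≤ n.primeFactors.card, (1 : ℝ) := by simp
      _ ≤ ∑ n ∈ I.filter fun n => L / 8 ≤ n.primeFactors.card,
            X * Real.exp (-(2 * L)) * ((T : ℝ) ^ n.primeFactors.card / n) := by
          refine Finset.sum_le_sum fun n hn => ?_
          rw [Finset.mem_filter] at hn
          have hn1 := Finset.mem_Icc.1 hn.1
          have hnX : (n : ℝ) ≤ X := (Nat.le_floor_iff (by linarith)).1 hn1.2
          have hn0 : (0 : ℝ) < n := by exact_mod_cast hn1.1
          have h3 : Real.exp (2 * L) ≤ (T : ℝ) ^ n.primeFactors.card := by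
            calc Real.exp (2 * L) ≤ Real.exp (n.primeFactors.card * 16) :=
                  Real.exp_le_exp.2 (by linarith [hn.2])
              _ = Real.exp 16 ^ n.primeFactors.card := Real.exp_nat_mul _ _
              _ ≤ _ := by gcongr
          rw [Real.exp_neg, ← div_eq_mul_inv, div_mul_div_comm,
            le_div_iff₀ (by positivity), one_mul, mul_comm (Real.exp _)]
          gcongr
      _ ≤ ∑ n ∈ I, X * Real.exp (-(2 * L)) * ((T : ℝ) ^ n.primeFactors.card / n) :=
          Finset.sum_le_sum_of_subset_of_nonneg (Finset.filter_subset _ _)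
            fun _ _ _ => by positivity
      _ = X * Real.exp (-(2 * L)) * ∑ n ∈ I, (T : ℝ) ^ n.primeFactors.card / n := by
          rw [Finset.mul_sum]
      _ ≤ X * Real.exp (-(2 * L)) * (((2 * T + 1 : ℕ) : ℝ) ^ (2 * T) * Real.exp L) := by
          refine mul_le_mul_of_nonneg_left ?_ (by positivity)
          refine (sum_Icc_pow_card_primeFactors_div_le T _).trans ?_
          refine le_trans ?_ (one_add_sq_pow_le_mul_exp T hL0)
          rw [hL2]
          exact pow_le_pow_left₀ (Finset.sum_nonneg fun _ _ => by positivity)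
            (sum_Icc_inv_le_one_add_log hX) _
      _ = _ := by
          have : Real.exp (-L) = Real.exp (-(2 * L)) * Real.exp L := by
            rw [← Real.exp_add]; congr 1; ring
          rw [this]; ring
  have h1 : ((Finset.Icc 1 ⌊√X⌋₊).card : ℝ) ≤ 2 * (X * Real.exp (-L)) := by
    rw [Nat.card_Icc, Nat.add_sub_cancel]
    exact (Nat.floor_le (Real.sqrt_nonneg _)).trans (sqrt_le_two_mul_mul_exp_neg hX)
  calc (B.card : ℝ) ≤ ((Finset.Icc 1 ⌊√X⌋₊).card : ℝ) +
        ((I.filter fun n => L / 8 ≤ n.primeFactors.card).card : ℝ) := by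
        exact_mod_cast (Finset.card_le_card hsub).trans (Finset.card_union_le _ _)
    _ ≤ _ := by linarith

/-! ### Counting square-free integers -/

-- Write `n = b² a` with `a` square-free: then `d² ∣ n` exactly when `d ∣ b`, and the Möbius sum
-- over the divisors of `b` detects `b = 1`.
open ArithmeticFunction in
theorem sum_moebius_filter_sq_dvd {n D : ℕ} (hn : n ≠ 0) (hD : ∀ d, d ^ 2 ∣ n → d ≤ D) :
    ∑ d ∈ (Finset.Icc 1 D).filter (fun d => d ^ 2 ∣ n), (moebius d : ℤ) =
      if Squarefree n then 1 else 0 := by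
  obtain ⟨a, b, hba, ha⟩ := Nat.sq_mul_squarefree n
  have hb0 : b ≠ 0 := by rintro rfl; simp at hba; omega
  have ha0 : a ≠ 0 := ha.ne_zero
  have h1 : (Finset.Icc 1 D).filter (fun d => d ^ 2 ∣ n) = b.divisors := by
    ext d
    rw [Finset.mem_filter, Finset.mem_Icc, Nat.mem_divisors]
    constructor
    · rintro ⟨⟨h1, _⟩, h3⟩
      refine ⟨?_, hb0⟩
      rw [← hba] at h3
      have hd0 : d ≠ 0 := by omega
      rw [← Nat.factorization_le_iff_dvd hd0 hb0]
      intro p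
      have h4 := (Nat.factorization_le_iff_dvd (pow_ne_zero 2 hd0)
        (mul_ne_zero (pow_ne_zero 2 hb0) ha0)).2 h3 p
      have h5 := ha.natFactorization_le_one p
      rw [Nat.factorization_mul (pow_ne_zero 2 hb0) ha0, Nat.factorization_pow,
        Nat.factorization_pow] at h4
      simp only [Finsupp.add_apply, Finsupp.smul_apply, smul_eq_mul] at h4
      omega
    · rintro ⟨h1, _⟩
      have h2 : d ^ 2 ∣ n := by
        rw [← hba]; exact (pow_dvd_pow_of_dvd h1 2).trans (Dvd.intro _ rfl)
      exact ⟨⟨Nat.pos_of_dvd_of_pos h1 (Nat.pos_of_ne_zero hb0), hD d h2⟩, h2⟩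
  have h2 : Squarefree n ↔ b = 1 := by
    constructor
    · intro h
      exact Nat.isUnit_iff.1 (h b ⟨a, by rw [← hba]; ring⟩)
    · rintro rfl
      rw [← hba]; simpa using ha
  have h3 := congrArg (fun f : ArithmeticFunction ℤ => f b) moebius_mul_coe_zeta
  simp only [coe_mul_zeta_apply, one_apply] at h3
  rw [h1, h3]
  simp only [h2]

theorem tendsto_sum_moebius_div_sq :
    Tendsto (fun K : ℕ => ∑ d ∈ Finset.Icc 1 K, (ArithmeticFunction.moebius d : ℝ) / (d : ℝ) ^ 2)
      atTop (𝓝 (1 / zetaTwo)) := by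
  have h2 : (1 : ℝ) < (2 : ℂ).re := by norm_num
  have hz : LSeries 1 2 = (zetaTwo : ℂ) := by
    rw [LSeries_one_eq_riemannZeta h2, zeta_eq_tsum_one_div_nat_add_one_cpow h2, zetaTwo,
      Complex.ofReal_tsum]
    refine tsum_congr fun n => ?_
    push_cast
    norm_cast
  have hmul := LSeries_one_mul_Lseries_moebius h2
  rw [hz] at hmul
  have hM : LSeries (fun n => (ArithmeticFunction.moebius n : ℂ)) 2 = ((1 / zetaTwo : ℝ) : ℂ) := by
    push_cast
    exact eq_one_div_of_mul_eq_one_right hmul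
  have hs := (ArithmeticFunction.LSeriesSummable_moebius_iff.2 h2).hasSum.tendsto_sum_nat
  change Tendsto _ atTop (𝓝 (LSeries (fun n => (ArithmeticFunction.moebius n : ℂ)) 2)) at hs
  rw [hM] at hs
  have hr := (Complex.continuous_re.tendsto _).comp (hs.comp (tendsto_add_atTop_nat 1))
  rw [Complex.ofReal_re] at hr
  refine hr.congr fun K => ?_
  simp only [Function.comp]
  rw [Finset.sum_range_succ', LSeries.term_zero, add_zero, Complex.re_sum,
    Finset.sum_bij (fun i _ => i + 1)]
  · intro i hi
    simp only [Finset.mem_range] at hi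
    simp only [Finset.mem_Icc]; omega
  · intro i _ j _ h; omega
  · intro i hi
    simp only [Finset.mem_Icc] at hi
    exact ⟨i - 1, by simp only [Finset.mem_range]; omega, by omega⟩
  · intro i _
    rw [LSeries.term_of_ne_zero (by omega)]
    have : (ArithmeticFunction.moebius (i + 1) : ℂ) / ((i + 1 : ℕ) : ℂ) ^ (2 : ℂ) =
        (((ArithmeticFunction.moebius (i + 1) : ℝ) / ((i + 1 : ℕ) : ℝ) ^ 2 : ℝ) : ℂ) := by
      push_cast
      norm_cast
    rw [this, Complex.ofReal_re]

theorem abs_moebius_div_le (d : ℕ) (x : ℝ) (hx : 0 ≤ x) :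
    |(ArithmeticFunction.moebius d : ℝ) / x| ≤ x⁻¹ := by
  have h : |(ArithmeticFunction.moebius d : ℝ)| ≤ 1 := by
    exact_mod_cast ArithmeticFunction.abs_moebius_le_one
  rw [abs_div, abs_of_nonneg hx, div_eq_mul_inv]
  exact mul_le_of_le_one_left (by positivity) h

theorem abs_sum_moebius_div_sq_sub_le (D : ℕ) :
    |1 / zetaTwo - ∑ d ∈ Finset.Icc 1 D, (ArithmeticFunction.moebius d : ℝ) / (d : ℝ) ^ 2| ≤
      ((D + 1 : ℝ) ^ 2)⁻¹ + (D + 1 : ℝ)⁻¹ := by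
  refine le_of_tendsto (tendsto_sum_moebius_div_sq.sub_const _).abs ?_
  filter_upwards [eventually_ge_atTop (D + 1)] with K hK
  have h1 : Finset.Icc 1 K = Finset.Icc 1 D ∪ Finset.Ioc D K := by
    ext x; simp only [Finset.mem_union, Finset.mem_Icc, Finset.mem_Ioc]; omega
  have h2 : Disjoint (Finset.Icc 1 D) (Finset.Ioc D K) := by
    rw [Finset.disjoint_left]; intro x
    simp only [Finset.mem_Icc, Finset.mem_Ioc]; omega
  -- Peeling off `d = D + 1` leaves a tail bounded by `1/(D + 1)`, which fits `√X < D + 1` for `D =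
  -- ⌊√X⌋`.
  have h3 : Finset.Ioc D K = insert (D + 1) (Finset.Ioc (D + 1) K) := by
    ext x; simp only [Finset.mem_insert, Finset.mem_Ioc]; omega
  rw [h1, Finset.sum_union h2, add_sub_cancel_left]
  calc |∑ d ∈ Finset.Ioc D K, (ArithmeticFunction.moebius d : ℝ) / (d : ℝ) ^ 2|
      ≤ ∑ d ∈ Finset.Ioc D K, |(ArithmeticFunction.moebius d : ℝ) / (d : ℝ) ^ 2| :=
        Finset.abs_sum_le_sum_abs _ _
    _ ≤ ∑ d ∈ Finset.Ioc D K, ((d : ℝ) ^ 2)⁻¹ :=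
        Finset.sum_le_sum fun d _ => abs_moebius_div_le _ _ (by positivity)
    _ = ((D + 1 : ℝ) ^ 2)⁻¹ + ∑ d ∈ Finset.Ioc (D + 1) K, ((d : ℝ) ^ 2)⁻¹ := by
        rw [h3, Finset.sum_insert (by simp)]; push_cast; rfl
    _ ≤ _ := by
        have := sum_Ioc_inv_sq_le_sub (α := ℝ) (Nat.succ_ne_zero D) hK
        have h4 : (0 : ℝ) ≤ (K : ℝ)⁻¹ := by positivity
        push_cast at this
        linarith

/-- Rounding `X/d²` costs at most 1 for each `d ≤ √X`, and the tail of the Möbius series costs at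
most `1 + √X ≤ 2√X`. -/
theorem abs_card_squarefree_sub_le {X : ℝ} (hX : 1 ≤ X) :
    |(((Finset.Icc 1 ⌊X⌋₊).filter Squarefree).card : ℝ) - X / zetaTwo| ≤ 3 * √X := by
  set D := ⌊√X⌋₊ with hD
  set N := ⌊X⌋₊ with hN
  have hX0 : 0 < X := by linarith
  have hs1 : 1 ≤ √X := Real.one_le_sqrt.2 hX
  have hDs : (D : ℝ) ≤ √X := Nat.floor_le (Real.sqrt_nonneg _)
  have hsD : √X < D + 1 := Nat.lt_floor_add_one _
  have hcard : ((((Finset.Icc 1 N).filter Squarefree).card : ℤ)) =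
      ∑ d ∈ Finset.Icc 1 D, ArithmeticFunction.moebius d * ((N / d ^ 2 : ℕ) : ℤ) := by
    calc ((((Finset.Icc 1 N).filter Squarefree).card : ℤ))
        = ∑ n ∈ Finset.Icc 1 N, if Squarefree n then 1 else 0 := by
          rw [Finset.card_filter]; push_cast; rfl
      _ = ∑ n ∈ Finset.Icc 1 N, ∑ d ∈ (Finset.Icc 1 D).filter (fun d => d ^ 2 ∣ n),
            ArithmeticFunction.moebius d := by
          refine Finset.sum_congr rfl fun n hn => ?_
          have hn1 := Finset.mem_Icc.1 hn
          rw [sum_moebius_filter_sq_dvd (by omega)]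
          intro d hd
          have h1 : d ^ 2 ≤ N := (Nat.le_of_dvd (by omega) hd).trans hn1.2
          refine Nat.le_floor (Real.le_sqrt_of_sq_le ?_)
          exact_mod_cast (Nat.le_floor_iff hX0.le).1 h1
      _ = ∑ d ∈ Finset.Icc 1 D, ∑ n ∈ (Finset.Icc 1 N).filter (fun n => d ^ 2 ∣ n),
            ArithmeticFunction.moebius d := by
          refine Finset.sum_comm' fun n d => ?_
          simp only [Finset.mem_filter]; tauto
      _ = _ := by
          refine Finset.sum_congr rfl fun d _ => ?_
          have : Finset.Icc 1 N = Finset.Ioc 0 N := rfl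
          rw [Finset.sum_const, this, Nat.Ioc_filter_dvd_card_eq_div, nsmul_eq_mul, mul_comm]
  have hcardR : (((Finset.Icc 1 N).filter Squarefree).card : ℝ) =
      ∑ d ∈ Finset.Icc 1 D, (ArithmeticFunction.moebius d : ℝ) * ((N / d ^ 2 : ℕ) : ℝ) := by
    have := congrArg (Int.cast : ℤ → ℝ) hcard
    simpa only [Int.cast_sum, Int.cast_mul, Int.cast_natCast] using this
  have hfloor : ∀ d : ℕ, |((N / d ^ 2 : ℕ) : ℝ) - X / (d : ℝ) ^ 2| ≤ 1 := by
    intro d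
    have h1 : N / d ^ 2 = ⌊X / (d : ℝ) ^ 2⌋₊ := by
      have := Nat.floor_div_natCast X (d ^ 2)
      push_cast at this
      rw [this]
    rw [h1, abs_le]
    have h2 := Nat.floor_le (by positivity : 0 ≤ X / (d : ℝ) ^ 2)
    have h3 := Nat.lt_floor_add_one (X / (d : ℝ) ^ 2)
    constructor <;> linarith
  have h1 : |(((Finset.Icc 1 N).filter Squarefree).card : ℝ) -
      X * ∑ d ∈ Finset.Icc 1 D, (ArithmeticFunction.moebius d : ℝ) / (d : ℝ) ^ 2| ≤ √X := by
    rw [hcardR, Finset.mul_sum, ← Finset.sum_sub_distrib]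
    calc _ ≤ ∑ d ∈ Finset.Icc 1 D, |(ArithmeticFunction.moebius d : ℝ) * ((N / d ^ 2 : ℕ) : ℝ) -
            X * ((ArithmeticFunction.moebius d : ℝ) / (d : ℝ) ^ 2)| := Finset.abs_sum_le_sum_abs _ _
      _ ≤ ∑ d ∈ Finset.Icc 1 D, (1 : ℝ) := by
          refine Finset.sum_le_sum fun d _ => ?_
          have e : (ArithmeticFunction.moebius d : ℝ) * ((N / d ^ 2 : ℕ) : ℝ) -
            X * ((ArithmeticFunction.moebius d : ℝ) / (d : ℝ) ^ 2) =
            (ArithmeticFunction.moebius d : ℝ) * (((N / d ^ 2 : ℕ) : ℝ) - X / (d : ℝ) ^ 2) := by ring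
          have h : |(ArithmeticFunction.moebius d : ℝ)| ≤ 1 := by
            exact_mod_cast ArithmeticFunction.abs_moebius_le_one
          rw [e, abs_mul]
          exact mul_le_one₀ h (abs_nonneg _) (hfloor d)
      _ = D := by simp
      _ ≤ _ := hDs
  have h2 : |X * (∑ d ∈ Finset.Icc 1 D, (ArithmeticFunction.moebius d : ℝ) / (d : ℝ) ^ 2) -
      X / zetaTwo| ≤ 2 * √X := by
    have e : X * (∑ d ∈ Finset.Icc 1 D, (ArithmeticFunction.moebius d : ℝ) / (d : ℝ) ^ 2) -
      X / zetaTwo = -(X * (1 / zetaTwo -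
        ∑ d ∈ Finset.Icc 1 D, (ArithmeticFunction.moebius d : ℝ) / (d : ℝ) ^ 2)) := by ring
    rw [e, abs_neg, abs_mul, abs_of_pos hX0]
    have hss : √X * √X = X := Real.mul_self_sqrt hX0.le
    calc _ ≤ X * (((D + 1 : ℝ) ^ 2)⁻¹ + (D + 1 : ℝ)⁻¹) :=
          mul_le_mul_of_nonneg_left (abs_sum_moebius_div_sq_sub_le D) hX0.le
      _ ≤ X * ((√X ^ 2)⁻¹ + (√X)⁻¹) := by gcongr
      _ = 1 + √X := by
          rw [sq, hss, mul_add, mul_inv_cancel₀ hX0.ne']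
          nth_rw 1 [← hss]
          field_simp
      _ ≤ _ := by linarith
  have h3 := abs_add_le ((((Finset.Icc 1 N).filter Squarefree).card : ℝ) -
      X * ∑ d ∈ Finset.Icc 1 D, (ArithmeticFunction.moebius d : ℝ) / (d : ℝ) ^ 2)
    (X * (∑ d ∈ Finset.Icc 1 D, (ArithmeticFunction.moebius d : ℝ) / (d : ℝ) ^ 2) - X / zetaTwo)
  rw [sub_add_sub_cancel] at h3
  linarith

/-! ### Bounding the number of solutions -/

/-- Both `pm` and `qm` have `1 + ω(m)` prime factors, so the same values of `η` and `f` occur in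
both diagonal products. -/
theorem dvd_sq_sub_sq_of_kloostermanSum_eq {a b : ℤ} {η : ℕ → ℂ} {f : ArithmeticFunction ℂ}
    (hf : f.IsMultiplicative) {p q m m' : ℕ} (hp : p.Prime) (hq : q.Prime) (hpq : p ≠ q)
    (h5 : 5 ≤ p) (ha : ¬ (p : ℤ) ∣ a) (hb : ¬ (p : ℤ) ∣ b)
    (h : ∀ n ∈ ({p * m, p * m', q * m, q * m'} : Set ℕ), Squarefree n ∧
      kloostermanSum a b n = η (ArithmeticFunction.cardDistinctFactors n) * f n) :
    (p : ℤ) ∣ (m : ℤ) ^ 2 - (m' : ℤ) ^ 2 := by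
  obtain ⟨s1, e1⟩ := h (p * m) (by simp)
  obtain ⟨s2, e2⟩ := h (p * m') (by simp)
  obtain ⟨s3, e3⟩ := h (q * m) (by simp)
  obtain ⟨s4, e4⟩ := h (q * m') (by simp)
  have split : ∀ {r k : ℕ}, r.Prime → Squarefree (r * k) →
      η (ArithmeticFunction.cardDistinctFactors (r * k)) * f (r * k) =
        η (1 + ArithmeticFunction.cardDistinctFactors k) * (f r * f k) := by
    intro r k hr hs
    have hc := Nat.coprime_of_squarefree_mul hs
    rw [ArithmeticFunction.cardDistinctFactors_mul hc, hf.map_mul_of_coprime hc,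
      ArithmeticFunction.cardDistinctFactors_apply_prime hr]
  refine natCast_sq_eq_of_kloostermanSum_rectangle hp hq hpq h5 ha hb s1 s2 s3 s4 ?_
  rw [e1, e2, e3, e4, split hp s1, split hp s2, split hq s3, split hq s4]
  ring

/-- The product of these primes divides a nonzero integer of size at most `X² = exp(2L²)`, and each
prime is at least `exp(4L)`. -/
theorem card_le_of_prime_dvd_sq_sub_sq {X L : ℝ} (hL : 0 < L) (hX : X = Real.exp (L ^ 2))
    {m m' : ℕ} (hmm : m ≠ m') (hm : (m : ℝ) ≤ X) (hm' : (m' : ℝ) ≤ X) (C : Finset ℕ)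
    (hC : ∀ p ∈ C, p.Prime ∧ Real.exp (4 * L) ≤ p ∧ (p : ℤ) ∣ (m : ℤ) ^ 2 - (m' : ℤ) ^ 2) :
    (C.card : ℝ) ≤ L / 2 := by
  set K := ((m : ℤ) ^ 2 - (m' : ℤ) ^ 2).natAbs with hK
  have hK0 : K ≠ 0 := by
    rw [hK, Int.natAbs_ne_zero, sub_ne_zero]
    intro h
    apply hmm
    have : m ^ 2 = m' ^ 2 := by exact_mod_cast h
    exact Nat.pow_left_injective two_ne_zero this
  have hKX : (K : ℝ) ≤ X ^ 2 := by
    have h1 : (K : ℝ) = |(m : ℝ) ^ 2 - (m' : ℝ) ^ 2| := by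
      rw [hK, Nat.cast_natAbs]; push_cast; rfl
    have h2 : (m : ℝ) ^ 2 ≤ X ^ 2 := by gcongr
    have h3 : (m' : ℝ) ^ 2 ≤ X ^ 2 := by gcongr
    rw [h1, abs_le]
    constructor <;> nlinarith [sq_nonneg (m : ℝ), sq_nonneg (m' : ℝ)]
  have hdvd : ∏ p ∈ C, p ∣ K :=
    Finset.prod_primes_dvd K (fun p hp => (hC p hp).1.prime)
      fun p hp => Int.natCast_dvd.1 (hC p hp).2.2
  have h1 : Real.exp (4 * L) ^ C.card ≤ X ^ 2 := by
    calc Real.exp (4 * L) ^ C.card = ∏ p ∈ C, Real.exp (4 * L) := (Finset.prod_const _).symm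
      _ ≤ ∏ p ∈ C, (p : ℝ) :=
          Finset.prod_le_prod (fun _ _ => (Real.exp_pos _).le) fun p hp => (hC p hp).2.1
      _ = ((∏ p ∈ C, p : ℕ) : ℝ) := by push_cast; rfl
      _ ≤ K := by exact_mod_cast Nat.le_of_dvd (Nat.pos_of_ne_zero hK0) hdvd
      _ ≤ _ := hKX
  rw [hX, ← Real.exp_nat_mul, ← Real.exp_nat_mul, Real.exp_le_exp] at h1
  push_cast at h1
  have h2 : L * (4 * C.card) ≤ L * (2 * L) := by nlinarith
  have := le_of_mul_le_mul_left h2 hL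
  linarith

/-- At most `|a|` primes divide `a`, and each one counted has at most `X/y` multiples up to `X`. The
dependence on `a` and `b` enters only here. -/
theorem card_filter_exists_prime_dvd_le {X y : ℝ} (hX : 0 ≤ X) (hy : 0 < y) {a : ℤ} (ha : a ≠ 0)
    (S : Finset ℕ) (hS : ∀ n ∈ S, 1 ≤ n ∧ (n : ℝ) ≤ X ∧
      ∃ p : ℕ, p.Prime ∧ y ≤ p ∧ p ∣ n ∧ (p : ℤ) ∣ a) :
    (S.card : ℝ) ≤ |(a : ℝ)| * (X / y) := by
  classical
  set F := a.natAbs.primeFactors.filter fun p : ℕ => y ≤ p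
  have hsub : S ⊆ F.biUnion fun p => (Finset.Ioc 0 ⌊X⌋₊).filter fun n => p ∣ n := by
    intro n hn
    obtain ⟨h1, h2, p, hp, hyp, hpn, hpa⟩ := hS n hn
    simp only [F, Finset.mem_biUnion, Finset.mem_filter, Finset.mem_Ioc, Nat.mem_primeFactors]
    exact ⟨p, ⟨⟨hp, Int.natCast_dvd.1 hpa, Int.natAbs_ne_zero.2 ha⟩, hyp⟩,
      ⟨h1, Nat.le_floor h2⟩, hpn⟩
  have hF : (F.card : ℝ) ≤ |(a : ℝ)| := by
    have h1 : F ⊆ Finset.Icc 1 a.natAbs := by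
      intro p hp
      have h2 := (Finset.mem_filter.1 hp).1
      rw [Finset.mem_Icc]
      exact ⟨(Nat.prime_of_mem_primeFactors h2).one_le, Nat.le_of_mem_primeFactors h2⟩
    have h2 := Finset.card_le_card h1
    rw [Nat.card_Icc, Nat.add_sub_cancel] at h2
    have h3 : ((a.natAbs : ℕ) : ℝ) = |(a : ℝ)| := by rw [Nat.cast_natAbs]; push_cast; rfl
    rw [← h3]
    exact_mod_cast h2
  calc (S.card : ℝ) ≤ ∑ p ∈ F, (((Finset.Ioc 0 ⌊X⌋₊).filter fun n => p ∣ n).card : ℝ) := by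
        exact_mod_cast (Finset.card_le_card hsub).trans Finset.card_biUnion_le
    _ ≤ ∑ p ∈ F, X / y := by
        refine Finset.sum_le_sum fun p hp => ?_
        rw [Nat.Ioc_filter_dvd_card_eq_div]
        calc ((⌊X⌋₊ / p : ℕ) : ℝ) ≤ (⌊X⌋₊ : ℝ) / p := Nat.cast_div_le
          _ ≤ X / y := div_le_div₀ hX (Nat.floor_le hX) hy (Finset.mem_filter.1 hp).2
    _ = F.card * (X / y) := by rw [Finset.sum_const, nsmul_eq_mul]
    _ ≤ _ := by gcongr

theorem ncard_setOf_le_eq_card_filter (X : ℝ) (hX : 0 ≤ X) (P : ℕ → Prop) [DecidablePred P] :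
    Set.ncard {n : ℕ | 1 ≤ n ∧ (n : ℝ) ≤ X ∧ P n} = ((Finset.Icc 1 ⌊X⌋₊).filter P).card := by
  rw [← Set.ncard_coe_finset]
  congr 1
  ext n
  simp only [Set.mem_ofPred_eq, Finset.coe_filter, Finset.mem_Icc, Nat.le_floor_iff hX, and_assoc]

theorem exists_kloostermanEqCount_le : ∃ β : ℝ, 0 ≤ β ∧ ∀ a b : ℤ, a ≠ 0 → b ≠ 0 →
    ∀ (η : ℕ → ℂ) (f : ArithmeticFunction ℂ), f.IsMultiplicative → ∀ X : ℝ, 1 ≤ X →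
      kloostermanEqCount a b η f X ≤
        primePi X + (|(a : ℝ)| + |(b : ℝ)| + β) * (X * Real.exp (-√(Real.log X))) := by
  classical
  obtain ⟨C, hC0, hC⟩ := exists_card_squarefree_smooth_le
  refine ⟨C + 36, by positivity, fun a b ha hb η f hf X hX => ?_⟩
  have hX0 : 0 < X := by linarith
  set L := √(Real.log X) with hL
  have hL2 : L ^ 2 = Real.log X := Real.sq_sqrt (Real.log_nonneg hX)
  have hLX : X = Real.exp (L ^ 2) := by rw [hL2, Real.exp_log hX0]
  set N := ⌊X⌋₊ with hN
  have hNX : (N : ℝ) ≤ X := Nat.floor_le hX0.le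
  set good : ℕ → Prop := fun n => Squarefree n ∧
    kloostermanSum a b n = η (ArithmeticFunction.cardDistinctFactors n) * f n with hgood
  set G := (Finset.Icc 1 N).filter good with hG
  have hcount : kloostermanEqCount a b η f X = G.card := by
    rw [kloostermanEqCount, hG, ← ncard_setOf_le_eq_card_filter X hX0.le good]
  have hpi : 0 ≤ primePi X := Nat.cast_nonneg _
  rw [hcount]
  -- For `L < 1` the trivial bound `X` suffices. For `L ≥ 1`, `y ≥ 4L + 1 ≥ 5`, so every prime above
  -- `Y` is admissible in the rectangle lemma.
  rcases lt_or_ge L 1 with hL1 | hL1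
  · have h1 : (G.card : ℝ) ≤ X := by
      refine le_trans ?_ hNX
      have := Finset.card_filter_le (Finset.Icc 1 N) good
      rw [Nat.card_Icc, Nat.add_sub_cancel] at this
      exact_mod_cast this
    have h2 : X ≤ 36 * (X * Real.exp (-L)) := by
      have h3 : Real.exp L ≤ 36 := by
        have := Real.exp_le_exp.2 hL1.le
        linarith [Real.exp_one_lt_d9]
      rw [Real.exp_neg, ← mul_assoc, ← div_eq_mul_inv, le_div_iff₀ (Real.exp_pos _)]
      nlinarith
    have h3 : 0 ≤ (|(a : ℝ)| + |(b : ℝ)| + C) * (X * Real.exp (-L)) := by positivity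
    linarith
  have hLpos : 0 < L := by linarith
  set y := Real.exp (4 * L) with hy
  have hy5 : 5 ≤ y := by have := Real.add_one_le_exp (4 * L); linarith
  set Y := ⌊y⌋₊ with hY
  have hY5 : 5 ≤ Y := Nat.le_floor (by exact_mod_cast hy5)
  set P := (Finset.Icc 1 N).filter fun p => p.Prime ∧ Y < p ∧ ¬ (p : ℤ) ∣ a ∧ ¬ (p : ℤ) ∣ b with hP
  set A : ℕ → Finset ℕ := fun p => (Finset.Icc 1 N).filter fun m => p * m ≤ N ∧ good (p * m) with hA
  have hyp : ∀ p : ℕ, Y < p → y ≤ p := fun p hp => (Nat.lt_of_floor_lt hp).le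
  -- A rectangle needs a second prime `q ≠ p`; the summand 1 covers a single common neighbour.
  have hcommon : ∀ m m', m ≠ m' →
      ((P.filter fun p => m ∈ A p ∧ m' ∈ A p).card : ℝ) ≤ 1 + L / 2 := by
    intro m m' hmm
    set D := P.filter fun p => m ∈ A p ∧ m' ∈ A p
    rcases le_or_gt D.card 1 with h1 | h1
    · have : (D.card : ℝ) ≤ 1 := by exact_mod_cast h1
      linarith
    · have hD : ∀ p ∈ D, p.Prime ∧ Y < p ∧ ¬ (p : ℤ) ∣ a ∧ ¬ (p : ℤ) ∣ b ∧ m ∈ A p ∧ m' ∈ A p := by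
        intro p hp
        simp only [D, hP, Finset.mem_filter] at hp
        tauto
      obtain ⟨p₀, hp₀⟩ := Finset.card_pos.1 (by omega : 0 < D.card)
      obtain ⟨_, _, _, _, hm0, hm0'⟩ := hD p₀ hp₀
      have hle : ∀ k ∈ A p₀, (k : ℝ) ≤ X := fun k hk =>
        (Nat.le_floor_iff hX0.le).1 (Finset.mem_Icc.1 (Finset.mem_filter.1 hk).1).2
      have := card_le_of_prime_dvd_sq_sub_sq hLpos hLX hmm (hle m hm0) (hle m' hm0') D ?_
      · linarith
      · intro p hp
        obtain ⟨q, hq, hqp⟩ := Finset.exists_mem_ne h1 p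
        obtain ⟨p1, p2, p3, p4, p5, p6⟩ := hD p hp
        obtain ⟨q1, q2, q3, q4, q5, q6⟩ := hD q hq
        refine ⟨p1, hyp p p2, dvd_sq_sub_sq_of_kloostermanSum_eq (η := η) hf p1 q1 hqp.symm
          (by omega) p3 p4 ?_⟩
        intro n hn
        simp only [Set.mem_insert_iff, Set.mem_singleton_iff] at hn
        rcases hn with rfl | rfl | rfl | rfl
        · exact (Finset.mem_filter.1 p5).2.2
        · exact (Finset.mem_filter.1 p6).2.2
        · exact (Finset.mem_filter.1 q5).2.2
        · exact (Finset.mem_filter.1 q6).2.2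
  have hedges := sum_card_le_of_card_common_le hX (by omega : 1 ≤ Y) (by positivity : 0 ≤ 1 + L / 2)
    P A (fun p hp => by
      have h := Finset.mem_filter.1 hp
      exact ⟨h.2.2.1, (Nat.le_floor_iff hX0.le).1 (Finset.mem_Icc.1 h.1).2⟩)
    (fun p hp m hm => by
      have h := Finset.mem_filter.1 hm
      refine ⟨(Finset.mem_Icc.1 h.1).1, ?_⟩
      exact_mod_cast (Nat.le_floor_iff hX0.le).1 h.2.1) hcommon
  have hPcard : (P.card : ℝ) ≤ primePi X := by
    rw [primePi, ← Nat.primesLE_card_eq_primeCounting]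
    norm_cast
    refine Finset.card_le_card fun p hp => ?_
    have h := Finset.mem_filter.1 hp
    rw [Nat.mem_primesLE]
    exact ⟨(Finset.mem_Icc.1 h.1).2, h.2.1⟩
  set S := G.filter fun n => ∀ p : ℕ, p ∈ n.primeFactors → (p : ℝ) ≤ y
  set Ba := G.filter fun n => ∃ p : ℕ, p.Prime ∧ y ≤ p ∧ p ∣ n ∧ (p : ℤ) ∣ a
  set Bb := G.filter fun n => ∃ p : ℕ, p.Prime ∧ y ≤ p ∧ p ∣ n ∧ (p : ℤ) ∣ b
  have hGmem : ∀ n ∈ G, 1 ≤ n ∧ n ≤ N ∧ good n := by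
    intro n hn
    rw [hG, Finset.mem_filter, Finset.mem_Icc] at hn
    exact ⟨hn.1.1, hn.1.2, hn.2⟩
  have hcover : G ⊆ (S ∪ (Ba ∪ Bb)) ∪ P.biUnion fun p => (A p).image (p * ·) := by
    intro n hn
    obtain ⟨n1, n2, n3⟩ := hGmem n hn
    by_cases h1 : n ∈ S
    · exact Finset.mem_union_left _ (Finset.mem_union_left _ h1)
    have h2 : ∃ p ∈ n.primeFactors, y < p := by
      by_contra! h
      exact h1 (Finset.mem_filter.2 ⟨hn, h⟩)
    obtain ⟨p, hp, hyp'⟩ := h2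
    have hpp := Nat.prime_of_mem_primeFactors hp
    have hpn := Nat.dvd_of_mem_primeFactors hp
    by_cases h3 : (p : ℤ) ∣ a
    · refine Finset.mem_union_left _ (Finset.mem_union_right _ (Finset.mem_union_left _ ?_))
      exact Finset.mem_filter.2 ⟨hn, p, hpp, hyp'.le, hpn, h3⟩
    by_cases h4 : (p : ℤ) ∣ b
    · refine Finset.mem_union_left _ (Finset.mem_union_right _ (Finset.mem_union_right _ ?_))
      exact Finset.mem_filter.2 ⟨hn, p, hpp, hyp'.le, hpn, h4⟩
    refine Finset.mem_union_right _ (Finset.mem_biUnion.2 ⟨p, ?_, ?_⟩)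
    · rw [hP, Finset.mem_filter, Finset.mem_Icc]
      exact ⟨⟨hpp.one_le, (Nat.le_of_dvd n1 hpn).trans n2⟩, hpp,
        (Nat.floor_lt (by positivity)).2 hyp', h3, h4⟩
    · obtain ⟨m, rfl⟩ := hpn
      refine Finset.mem_image.2 ⟨m, ?_, rfl⟩
      rw [hA, Finset.mem_filter, Finset.mem_Icc]
      have hm : 0 < m := Nat.pos_of_mul_pos_left n1
      exact ⟨⟨hm, (Nat.le_mul_of_pos_left m hpp.pos).trans n2⟩, n2, n3⟩
  have hScard : (S.card : ℝ) ≤ C * (X * Real.exp (-L)) := by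
    refine le_trans ?_ (hC X hX)
    norm_cast
    refine Finset.card_le_card fun n hn => ?_
    obtain ⟨h1, h2⟩ := Finset.mem_filter.1 hn
    obtain ⟨n1, n2, n3⟩ := hGmem n h1
    exact Finset.mem_filter.2 ⟨Finset.mem_Icc.2 ⟨n1, n2⟩, n3.1, h2⟩
  have hyL : X / y ≤ X * Real.exp (-L) := by
    rw [hy, div_eq_mul_inv, ← Real.exp_neg]
    gcongr
    linarith
  have hB : ∀ c : ℤ, c ≠ 0 → ((G.filter fun n => ∃ p : ℕ, p.Prime ∧ y ≤ p ∧ p ∣ n ∧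
      (p : ℤ) ∣ c).card : ℝ) ≤ |(c : ℝ)| * (X * Real.exp (-L)) := by
    intro c hc
    refine (card_filter_exists_prime_dvd_le hX0.le (by positivity : 0 < y) hc _ ?_).trans
      (mul_le_mul_of_nonneg_left hyL (abs_nonneg _))
    intro n hn
    obtain ⟨h1, h2⟩ := Finset.mem_filter.1 hn
    obtain ⟨n1, n2, _⟩ := hGmem n h1
    exact ⟨n1, (Nat.le_floor_iff hX0.le).1 n2, h2⟩
  have hcard : (G.card : ℝ) ≤ S.card + (Ba.card + Bb.card) + ∑ p ∈ P, ((A p).card : ℝ) := by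
    have h1 : (P.biUnion fun p => (A p).image (p * ·)).card ≤ ∑ p ∈ P, (A p).card :=
      Finset.card_biUnion_le.trans (Finset.sum_le_sum fun p _ => Finset.card_image_le)
    have h2 := Finset.card_le_card hcover
    have h3 := Finset.card_union_le (S ∪ (Ba ∪ Bb)) (P.biUnion fun p => (A p).image (p * ·))
    have h4 := Finset.card_union_le S (Ba ∪ Bb)
    have h5 := Finset.card_union_le Ba Bb
    have : G.card ≤ S.card + (Ba.card + Bb.card) + ∑ p ∈ P, (A p).card := by omega
    exact_mod_cast this
  -- As `√Y ≥ exp(2L)/2`, the gain is `exp(-2L)`; the factor `18(1 + L) ≤ 18 exp L` uses up half of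
  -- it.
  have herr : (2 + 16 * (1 + L / 2)) * (X / √(Y : ℝ)) ≤ 36 * (X * Real.exp (-L)) := by
    have hYy : y / 4 ≤ Y := by
      have := Nat.lt_floor_add_one y
      linarith
    have h1 : Real.exp (2 * L) / 2 ≤ √(Y : ℝ) := by
      refine Real.le_sqrt_of_sq_le (le_trans (le_of_eq ?_) hYy)
      rw [div_pow, ← Real.exp_nat_mul, hy]
      norm_num
      ring
    have h2 : X / √(Y : ℝ) ≤ 2 * (X * Real.exp (-(2 * L))) := by
      rw [Real.exp_neg]
      calc X / √(Y : ℝ) ≤ X / (Real.exp (2 * L) / 2) := by gcongr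
        _ = _ := by field_simp
    have h3 : 1 + L ≤ Real.exp L := by linarith [Real.add_one_le_exp L]
    calc (2 + 16 * (1 + L / 2)) * (X / √(Y : ℝ))
        ≤ (18 * (1 + L)) * (2 * (X * Real.exp (-(2 * L)))) := by
          gcongr
          linarith
      _ ≤ (18 * Real.exp L) * (2 * (X * Real.exp (-(2 * L)))) := by gcongr
      _ = 36 * (X * (Real.exp L * Real.exp (-(2 * L)))) := by ring
      _ = _ := by rw [← Real.exp_add]; congr 3; ring
  have h1 := hB a ha
  have h2 := hB b hb
  calc (G.card : ℝ) ≤ _ := hcard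
    _ ≤ C * (X * Real.exp (-L)) + (|(a : ℝ)| * (X * Real.exp (-L)) +
          |(b : ℝ)| * (X * Real.exp (-L))) + (primePi X + 36 * (X * Real.exp (-L))) := by
        gcongr
        linarith
    _ = _ := by ring

/-! ### From the solution count to the asymptotics of `N(X)` -/

theorem kloostermanNeCount_eq_sub (a b : ℤ) (η : ℕ → ℂ) (f : ArithmeticFunction ℂ) {X : ℝ}
    (hX : 0 ≤ X) :
    kloostermanNeCount a b η f X = squarefreeCount X - kloostermanEqCount a b η f X := by
  classical
  rw [kloostermanNeCount, squarefreeCount, kloostermanEqCount,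
    ncard_setOf_le_eq_card_filter X hX, ncard_setOf_le_eq_card_filter X hX,
    ncard_setOf_le_eq_card_filter X hX, eq_sub_iff_add_eq]
  rw [← Finset.filter_filter, ← Finset.filter_filter, add_comm]
  exact_mod_cast Finset.card_filter_add_card_filter_not _

theorem abs_squarefreeCount_sub_le {X : ℝ} (hX : 1 ≤ X) :
    |squarefreeCount X - X / zetaTwo| ≤ 3 * √X := by
  rw [squarefreeCount, ncard_setOf_le_eq_card_filter X (by linarith)]
  exact abs_card_squarefree_sub_le hX

theorem zetaTwo_pos : 0 < zetaTwo := by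
  have hs : Summable fun m : ℕ => 1 / ((m : ℝ) + 1) ^ 2 := by
    have := (summable_nat_add_iff 1).2 (Real.summable_one_div_nat_pow.2 one_lt_two)
    simpa using this
  exact hs.tsum_pos (fun m => by positivity) 0 (by norm_num)

theorem tendsto_primePi_div_atTop : Tendsto (fun X : ℝ => primePi X / X) atTop (𝓝 0) := by
  have h1 : Tendsto (fun X : ℝ => Real.log 4 / Real.log √X + (√X)⁻¹) atTop (𝓝 0) := by
    have hl : Tendsto (fun X : ℝ => Real.log √X) atTop atTop :=
      Real.tendsto_log_atTop.comp Real.tendsto_sqrt_atTop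
    simpa using (hl.const_div_atTop (Real.log 4)).add
      (tendsto_inv_atTop_zero.comp Real.tendsto_sqrt_atTop)
  refine squeeze_zero' ?_ ?_ h1
  · filter_upwards [eventually_ge_atTop 0] with X hX
    exact div_nonneg (Nat.cast_nonneg _) hX
  · filter_upwards [eventually_gt_atTop 1] with X hX
    have h2 := Chebyshev.pi_le_log4_mul_div hX
    have hX0 : 0 < X := by linarith
    rw [div_le_iff₀ hX0]
    refine h2.trans (le_of_eq ?_)
    have hs : √X * √X = X := Real.mul_self_sqrt hX0.le
    have hs0 : √X ≠ 0 := (Real.sqrt_pos.2 hX0).ne'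
    rw [add_mul]
    congr 1
    · ring
    · nth_rw 3 [← hs]
      field_simp

theorem tendsto_exp_neg_sqrt_log_atTop :
    Tendsto (fun X : ℝ => Real.exp (-√(Real.log X))) atTop (𝓝 0) :=
  Real.tendsto_exp_neg_atTop_nhds_zero.comp
    (Real.tendsto_sqrt_atTop.comp Real.tendsto_log_atTop)

/-- Chebyshev gives `π(X) ≥ X/(4 log X)`, and `log X = L² ≤ 2 exp L`. This absorbs the error terms
into `O(π(X))`. -/
theorem eventually_mul_exp_neg_sqrt_log_le_primePi :
    ∀ᶠ X : ℝ in atTop, X * Real.exp (-√(Real.log X)) ≤ 8 * primePi X := by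
  have hlog : ∀ᶠ X : ℝ in atTop, Real.log (X + 2) ≤ 1 / 10 * (X + 2) := by
    have := (Real.isLittleO_log_id_atTop.bound (by norm_num : (0 : ℝ) < 1 / 10))
    filter_upwards [(tendsto_atTop_add_const_right atTop (2 : ℝ) tendsto_id).eventually this,
      eventually_ge_atTop 1] with X hX h1
    simp only [id, Real.norm_eq_abs] at hX
    rw [abs_of_nonneg (by linarith : 0 ≤ X + 2)] at hX
    exact (le_abs_self _).trans hX
  filter_upwards [hlog, eventually_ge_atTop 100] with X h1 h2
  have hX0 : 0 < X := by linarith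
  have hL : 0 < Real.log X := Real.log_pos (by linarith)
  have hpi := Chebyshev.pi_ge' (by linarith : 1 < X)
  have h3 : X / 4 ≤ (X - 1) * Real.log 2 - Real.log (X + 2) := by
    have := Real.log_two_gt_d9
    nlinarith
  have h4 : X / 4 / Real.log X ≤ primePi X :=
    (div_le_div_of_nonneg_right h3 hL.le).trans hpi
  have h5 : Real.log X ≤ 2 * Real.exp (√(Real.log X)) := by
    have := Real.quadratic_le_exp_of_nonneg (Real.sqrt_nonneg (Real.log X))
    rw [Real.sq_sqrt hL.le] at this
    linarith [Real.sqrt_nonneg (Real.log X)]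
  refine le_trans ?_ (mul_le_mul_of_nonneg_left h4 (by norm_num : (0 : ℝ) ≤ 8))
  rw [Real.exp_neg, ← div_eq_mul_inv, div_div, mul_div_assoc',
    div_le_div_iff₀ (Real.exp_pos _) (by positivity)]
  nlinarith

theorem tendsto_squarefreeCount_div_atTop :
    Tendsto (fun X : ℝ => squarefreeCount X / X) atTop (𝓝 (1 / zetaTwo)) := by
  rw [← tendsto_sub_nhds_zero_iff]
  have h1 : Tendsto (fun X : ℝ => 3 * (√X)⁻¹) atTop (𝓝 0) := by
    simpa using (tendsto_inv_atTop_zero.comp Real.tendsto_sqrt_atTop).const_mul (3 : ℝ)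
  refine squeeze_zero_norm' ?_ h1
  filter_upwards [eventually_ge_atTop 1] with X hX
  have hX0 : 0 < X := by linarith
  have e : squarefreeCount X / X - 1 / zetaTwo = (squarefreeCount X - X / zetaTwo) / X := by
    field_simp
  rw [e, Real.norm_eq_abs, abs_div, abs_of_pos hX0, div_le_iff₀ hX0]
  refine (abs_squarefreeCount_sub_le hX).trans (le_of_eq ?_)
  have hs : √X * √X = X := Real.mul_self_sqrt hX0.le
  have hs0 : √X ≠ 0 := (Real.sqrt_pos.2 hX0).ne'
  nth_rw 3 [← hs]
  field_simp

theorem tendsto_kloostermanNeCount_div_squarefreeCount {a b : ℤ} {η : ℕ → ℂ}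
    {f : ArithmeticFunction ℂ} {c : ℝ}
    (h : ∀ X : ℝ, 1 ≤ X → kloostermanEqCount a b η f X ≤
      primePi X + c * (X * Real.exp (-√(Real.log X)))) :
    Tendsto (fun X : ℝ => kloostermanNeCount a b η f X / squarefreeCount X) atTop (𝓝 1) := by
  have hz : (1 / zetaTwo : ℝ) ≠ 0 := (one_div_pos.2 zetaTwo_pos).ne'
  have hE : Tendsto (fun X : ℝ => kloostermanEqCount a b η f X / X) atTop (𝓝 0) := by
    have h1 : Tendsto (fun X : ℝ => primePi X / X + c * Real.exp (-√(Real.log X)))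
        atTop (𝓝 0) := by
      simpa using tendsto_primePi_div_atTop.add (tendsto_exp_neg_sqrt_log_atTop.const_mul c)
    refine squeeze_zero' ?_ ?_ h1
    · filter_upwards [eventually_ge_atTop 0] with X hX
      exact div_nonneg (Nat.cast_nonneg _) hX
    · filter_upwards [eventually_ge_atTop 1] with X hX
      have hX0 : 0 < X := by linarith
      rw [div_le_iff₀ hX0]
      refine (h X hX).trans (le_of_eq ?_)
      field_simp
  have h2 := (tendsto_squarefreeCount_div_atTop.sub hE).div tendsto_squarefreeCount_div_atTop hz
  rw [sub_zero, div_self hz] at h2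
  refine h2.congr' ?_
  filter_upwards [eventually_ge_atTop 1] with X hX
  have hX0 : 0 < X := by linarith
  simp only [Pi.div_apply]
  rw [kloostermanNeCount_eq_sub a b η f hX0.le, ← sub_div, div_div_div_cancel_right₀ hX0.ne']

end

theorem theorem2 :
    ∃ β : ℝ, ∀ a b : ℤ, a ≠ 0 → b ≠ 0 →
      (∀ (η : ℕ → ℂ) (f : ArithmeticFunction ℂ), (∀ i, 1 ≤ i → η i ≠ 0) → f.IsMultiplicative →
        (∀ X : ℝ, 1 ≤ X →
          kloostermanEqCount a b η f X ≤
              primePi X + (10 * |(a : ℝ)| + 10 * |(b : ℝ)| + β) *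
                (X * Real.exp (-Real.sqrt (Real.log X))) ∧
          kloostermanNeCount a b η f X ≤ X / zetaTwo + 3 * Real.sqrt X ∧
          X / zetaTwo - primePi X - (10 * |(a : ℝ)| + 10 * |(b : ℝ)| + β + 6) *
              (X * Real.exp (-Real.sqrt (Real.log X))) ≤
            kloostermanNeCount a b η f X) ∧
        Tendsto (fun X : ℝ => kloostermanNeCount a b η f X / squarefreeCount X) atTop (𝓝 1)) ∧
      (∃ K X₀ : ℝ, ∀ (η : ℕ → ℂ) (f : ArithmeticFunction ℂ), (∀ i, 1 ≤ i → η i ≠ 0) →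
        f.IsMultiplicative → ∀ X : ℝ, X₀ ≤ X →
          |kloostermanNeCount a b η f X - X / zetaTwo| ≤ K * primePi X) := by

  obtain ⟨β, hβ0, hβ⟩ := exists_kloostermanEqCount_le
  refine ⟨β, fun a b ha hb => ?_⟩
  set c : ℝ := 10 * |(a : ℝ)| + 10 * |(b : ℝ)| + β with hc
  have hc0 : 0 ≤ c := by positivity
  have hE : ∀ (η : ℕ → ℂ) (f : ArithmeticFunction ℂ), f.IsMultiplicative → ∀ X : ℝ, 1 ≤ X →
      kloostermanEqCount a b η f X ≤ primePi X + c * (X * Real.exp (-√(Real.log X))) := by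
    intro η f hf X hX
    refine (hβ a b ha hb η f hf X hX).trans ?_
    have h1 : |(a : ℝ)| + |(b : ℝ)| + β ≤ c := by
      linarith [abs_nonneg (a : ℝ), abs_nonneg (b : ℝ)]
    gcongr
  have hupper : ∀ (η : ℕ → ℂ) (f : ArithmeticFunction ℂ) (X : ℝ), 1 ≤ X →
      kloostermanNeCount a b η f X ≤ X / zetaTwo + 3 * √X := by
    intro η f X hX
    rw [kloostermanNeCount_eq_sub a b η f (by linarith)]
    have h1 := (abs_le.1 (abs_squarefreeCount_sub_le hX)).2
    have h2 : 0 ≤ kloostermanEqCount a b η f X := Nat.cast_nonneg _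
    linarith
  have hlower : ∀ (η : ℕ → ℂ) (f : ArithmeticFunction ℂ), f.IsMultiplicative → ∀ X : ℝ, 1 ≤ X →
      X / zetaTwo - primePi X - (c + 6) * (X * Real.exp (-√(Real.log X))) ≤
        kloostermanNeCount a b η f X := by
    intro η f hf X hX
    rw [kloostermanNeCount_eq_sub a b η f (by linarith)]
    have h1 := (abs_le.1 (abs_squarefreeCount_sub_le hX)).1
    have h2 := sqrt_le_two_mul_mul_exp_neg hX
    have h3 := hE η f hf X hX
    linarith
  refine ⟨fun η f _ hf => ⟨fun X hX => ⟨hE η f hf X hX, hupper η f X hX, hlower η f hf X hX⟩,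
    tendsto_kloostermanNeCount_div_squarefreeCount (hE η f hf)⟩, ?_⟩
  obtain ⟨X₁, hX₁⟩ := eventually_atTop.1 eventually_mul_exp_neg_sqrt_log_le_primePi
  -- The lower bound costs `π(X)` plus `c + 6` error terms of size at most `8 π(X)`; the upper bound
  -- costs `3√X`, at most 6 such terms. The threshold `X₁` is absolute.
  refine ⟨1 + (c + 6) * 8, max X₁ 1, fun η f _ hf X hX => ?_⟩
  have h1 : 1 ≤ X := (le_max_right _ _).trans hX
  have h2 := hX₁ X ((le_max_left _ _).trans hX)
  have h3 := hupper η f X h1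
  have h4 := hlower η f hf X h1
  have h5 := sqrt_le_two_mul_mul_exp_neg h1
  have h6 : 0 ≤ primePi X := Nat.cast_nonneg _
  have h7 : (c + 6) * (X * Real.exp (-√(Real.log X))) ≤ (c + 6) * (8 * primePi X) :=
    mul_le_mul_of_nonneg_left h2 (by linarith)
  have h8 : 0 ≤ c * primePi X := mul_nonneg hc0 h6
  rw [abs_le]
  constructor <;> nlinarith
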